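/- Let $S$ be a set of positive integers and, for every $n\in S$, let $A_n=(\sigma^{(n)}_{ij})$ be an $n\times n$ matrix with nonnegative entries and let $V_n=\big(\tfrac1n(\sigma_{ij}^{(n)})^2\big)_{i,j}$ be its normalized variance profile. Call a $K\times K$ matrix with nonnegative entries fully indecomposable if for all nonempty $I,J\subset[K]$ with $|I|+|J|\ge K$ its submatrix with rows in $I$ and columns in $J$ has a nonzero entry. Assume: (A1) there is $\sigma_{\max}\in(0,\infty)$ with $\sigma^{(n)}_{ij}\le\sigma_{\max}$ for all $n\in S$ and $i,j\in[n]$; (A6) there are $\phi>0$ and $K\in\mathbb N$, independent of $n$, such that for every $n\in S$ there are a fully indecomposable matrix $Z=(z_{ij})\in\{0,1\}^{K\times K}$ and a partition $(I_j)_{j\in[K]}$ of $[n]$ with $|I_i|=n/K$ and $(V_n)_{xy}\ge\frac{\phi}{n}z_{ij}$ for all $i,j\in[K]$, $x\in I_i$, $y\in I_j$. For $s\ge0$, $t>0$ let $(\boldsymbol r(s,t),\tilde{\boldsymbol r}(s,t))\in(0,\infty)^{2n}$ be the unique positive solution of $$r_i=\frac{(V_n^{\mathsf T}\boldsymbol r)_i+t}{s^2+((V_n\tilde{\boldsymbol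 r})_i+t)((V_n^{\mathsf T}\boldsymbol r)_i+t)},\qquad \tilde r_i=\frac{(V_n\tilde{\boldsymbol r})_i+t}{s^2+((V_n\tilde{\boldsymbol r})_i+t)((V_n^{\mathsf T}\boldsymbol r)_i+t)},\qquad i\in[n].$$ Let $\rho(V_n)$ be the spectral radius of $V_n$. For $0<s<\sqrt{\rho(V_n)}$ let $(\boldsymbol q(s),\tilde{\boldsymbol q}(s))$ be the unique nonzero nonnegative solution of $$q_i=\frac{(V_n^{\mathsf T}\boldsymbol q)_i}{s^2+(V_n\tilde{\boldsymbol q})_i(V_n^{\mathsf T}\boldsymbol q)_i},\qquad \tilde q_i=\frac{(V_n\tilde{\boldsymbol q})_i}{s^2+(V_n\tilde{\boldsymbol q})_i(V_n^{\mathsf T}\boldsymbol q)_i},\qquad \sum_i q_i=\sum_i\tilde q_i,$$ and for $s\ge\sqrt{\rho(V_n)}$ let $(\boldsymbol q(s),\tilde{\boldsymbol q}(s))=0$. Put $F_n(s)=1-\frac1n\langle\boldsymbol q(s),V_n\tilde{\boldsymbol q}(s)\rangle$ for $s>0$, let $\mu_n$ be the radially symmetric probability measure on $\mathbb C$ with $\mu_n(\{|z|\le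 s\})=F_n(s)$ for all $s>0$, and let $f_n$ be its density on $\mathbb C\setminus\{0\}$ with respect to Lebesgue measure, given by $f_n(z)=\frac1{2\pi|z|}F_n'(|z|)$ for $|z|\notin\{0,\sqrt{\rho(V_n)}\}$ and $f_n(z)=0$ for $|z|=\sqrt{\rho(V_n)}$. Then, for every $n\in S$, the measure $\mu_n$ exists, $f_n$ is its density on $\mathbb C\setminus\{0\}$, and the following hold. (1) The limits $\lim_{t\downarrow0}(\boldsymbol r(0,t),\tilde{\boldsymbol r}(0,t))$ and $\lim_{s\downarrow0}(\boldsymbol q(s),\tilde{\boldsymbol q}(s))$ exist and are equal. Their common value $(\boldsymbol q(0),\tilde{\boldsymbol q}(0))$ satisfies $$q_i(0)\,(V_n\tilde{\boldsymbol q}(0))_i=1,\qquad \tilde q_i(0)\,(V_n^{\mathsf T}\boldsymbol q(0))_i=1,\qquad i\in[n].$$ In particular $\mu_n(\{0\})=0$. (2) The density $f_n$ has a limit $f_n(0)$ as $z\to0$, $z\neq0$, and $$f_n(0)=\frac1{\pi n}\sum_{i\in[n]}\frac1{(V_n^{\mathsf T}\boldsymbol q(0))_i\,(V_n\tilde{\boldsymbol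 q}(0))_i}=\frac1{\pi n}\sum_{i\in[n]}q_i(0)\,\tilde q_i(0).$$ Moreover there are finite constants $\kappa,C$ independent of $n\in S$ such that $0<\kappa\le f_n(0)\le C$ for all $n\in S$. -/

import Mathlib

open Set Filter Topology MeasureTheory
open scoped Matrix

noncomputable section

namespace VarianceProfile

/-- The normalized variance profile `V = n⁻¹ A ⊙ A` of a standard deviation profile `A`. -/
def normalizedProfile {n : ℕ} (A : Matrix (Fin n) (Fin n) ℝ) : Matrix (Fin n) (Fin n) ℝ :=
  Matrix.of fun i j => (A i j) ^ 2 / (n : ℝ)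

/-- The spectral radius `ρ(V)`: the largest modulus of a complex eigenvalue of `V`. -/
def rho {n : ℕ} (V : Matrix (Fin n) (Fin n) ℝ) : ℝ :=
  (spectralRadius ℂ (V.map (algebraMap ℝ ℂ))).toReal

/-- A nonnegative `K × K` matrix is fully indecomposable if each submatrix with nonempty row set
`I`, nonempty column set `J` and `|I| + |J| ≥ K` has a nonzero entry. -/
def FullyIndecomposable {K : ℕ} (T : Matrix (Fin K) (Fin K) ℝ) : Prop :=
  (∀ i j, 0 ≤ T i j) ∧
    ∀ I J : Finset (Fin K), I.Nonempty → J.Nonempty → K ≤ I.card + J.card →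
      ∃ i ∈ I, ∃ j ∈ J, T i j ≠ 0

/-- `V` is block fully indecomposable with constants `φ` and `K`. -/
def BlockFullyIndecomposable {n : ℕ} (φ : ℝ) (K : ℕ) (V : Matrix (Fin n) (Fin n) ℝ) : Prop :=
  ∃ Z : Matrix (Fin K) (Fin K) ℝ,
    (∀ i j, Z i j = 0 ∨ Z i j = 1) ∧ FullyIndecomposable Z ∧
    ∃ I : Fin K → Finset (Fin n),
      (∀ x, ∃! k, x ∈ I k) ∧
      (∀ k, ((I k).card : ℝ) = (n : ℝ) / (K : ℝ)) ∧
      ∀ i j, ∀ x ∈ I i, ∀ y ∈ I j, φ / (n : ℝ) * Z i j ≤ V x y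

/-- `p = (r, r̃)` is a (componentwise) positive solution of the regularized master equations
with parameters `s` and `t`. -/
def IsRegularizedSolution {n : ℕ} (V : Matrix (Fin n) (Fin n) ℝ) (s t : ℝ)
    (p : (Fin n → ℝ) × (Fin n → ℝ)) : Prop :=
  (∀ i, 0 < p.1 i) ∧ (∀ i, 0 < p.2 i) ∧
  (∀ i, p.1 i = ((Vᵀ *ᵥ p.1) i + t) /
    (s ^ 2 + ((V *ᵥ p.2) i + t) * ((Vᵀ *ᵥ p.1) i + t))) ∧
  (∀ i, p.2 i = ((V *ᵥ p.2) i + t) /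
    (s ^ 2 + ((V *ᵥ p.2) i + t) * ((Vᵀ *ᵥ p.1) i + t)))

open Classical in
/-- `(r(s,t), r̃(s,t))`: the positive solution of the regularized master equations
(`0` if there is none). -/
def regularizedSolution {n : ℕ} (V : Matrix (Fin n) (Fin n) ℝ) (s t : ℝ) :
    (Fin n → ℝ) × (Fin n → ℝ) :=
  if h : ∃ p, IsRegularizedSolution V s t p then h.choose else 0

/-- `p = (q, q̃)` is a nonnegative solution of the master equations with parameter `s`. -/
def IsMasterSolution {n : ℕ} (V : Matrix (Fin n) (Fin n) ℝ) (s : ℝ)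
    (p : (Fin n → ℝ) × (Fin n → ℝ)) : Prop :=
  (∀ i, 0 ≤ p.1 i) ∧ (∀ i, 0 ≤ p.2 i) ∧
  (∀ i, p.1 i = (Vᵀ *ᵥ p.1) i / (s ^ 2 + (V *ᵥ p.2) i * (Vᵀ *ᵥ p.1) i)) ∧
  (∀ i, p.2 i = (V *ᵥ p.2) i / (s ^ 2 + (V *ᵥ p.2) i * (Vᵀ *ᵥ p.1) i)) ∧
  ∑ i, p.1 i = ∑ i, p.2 i

open Classical in
/-- `(q(s), q̃(s))` for `s > 0`: the nontrivial nonnegative solution of the master equations when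
`s < √ρ(V)`, and `0` when `s ≥ √ρ(V)`. -/
def masterSolution {n : ℕ} (V : Matrix (Fin n) (Fin n) ℝ) (s : ℝ) :
    (Fin n → ℝ) × (Fin n → ℝ) :=
  if h : (0 < s ∧ s < Real.sqrt (rho V)) ∧ ∃ p, IsMasterSolution V s p ∧ p ≠ 0 then
    h.2.choose
  else 0

/-- `F(s) = 1 - n⁻¹ ⟨q(s), V q̃(s)⟩`, for `s > 0`. -/
def radialCDF {n : ℕ} (V : Matrix (Fin n) (Fin n) ℝ) (s : ℝ) : ℝ :=
  1 - (1 / (n : ℝ)) * ((masterSolution V s).1 ⬝ᵥ (V *ᵥ (masterSolution V s).2))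

/-- `μ` is a radially symmetric probability measure on `ℂ` with `μ {|z| ≤ s} = F(s)` for all
`s > 0`. -/
structure IsDeterministicEquivalent {n : ℕ} (V : Matrix (Fin n) (Fin n) ℝ)
    (μ : Measure ℂ) : Prop where
  prob : IsProbabilityMeasure μ
  radial : ∀ w : ℂ, ‖w‖ = 1 → μ.map (fun z => w * z) = μ
  cdf : ∀ s : ℝ, 0 < s → μ.real {z : ℂ | ‖z‖ ≤ s} = radialCDF V s

open Classical in
/-- The measure `μ_n` attached to `V` (the zero measure, which is not a probability measure, if
there is none). -/
def detEquivalent {n : ℕ} (V : Matrix (Fin n) (Fin n) ℝ) : Measure ℂ :=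
  if h : ∃ μ, IsDeterministicEquivalent V μ then h.choose else 0

open Classical in
/-- The density `f_n` on `ℂ \ {0}`: `f_n(z) = (2π|z|)⁻¹ F'(|z|)` off the circle `|z| = √ρ(V)`,
and `0` on that circle. -/
def density {n : ℕ} (V : Matrix (Fin n) (Fin n) ℝ) (z : ℂ) : ℝ :=
  if ‖z‖ = Real.sqrt (rho V) then 0
  else 1 / (2 * Real.pi * ‖z‖) * deriv (radialCDF V) ‖z‖

end VarianceProfile

end

open VarianceProfile

noncomputable section

namespace VarianceProfile

variable {n : ℕ} {V : Matrix (Fin n) (Fin n) ℝ}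

/-! ### Fully indecomposable matrices -/

/-! Write `τ = s²`, `a = Vᵀq + t`, `b = Vq̃ + t`. The equations become `q(τ + ba) = a` and `q̃(τ +
ba) = b`, a polynomial form that makes sense down to `τ = t = 0`, where it is the pair of
Sinkhorn-type identities. The theorem rests on existence, uniqueness and stability of the positive
solution with equal sums up to that corner.

Uniqueness (`IsPosSol.unique`) is a maximum principle: `q` increases with `a` and decreases with
`b`, so two solutions are compared through their largest ratio, and full indecomposability spreads
equality over all indices. Compactness is the quantitative heart: `IsBlockMap.sum_le` bounds the
mass of solutions in terms of `K`, `φ`, `σmax` and a bound on `τ`, because blocks of very large mass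
would send more flow into their neighbours than they can carry (`IsBlockMap.gap`). Pairing with the
Perron eigenvector shows that solutions cannot collapse to zero at a limit `τ < ρ(V)`. Hence both
limits in (1) equal the unique solution at `τ = t = 0`.

For (2), `1 - q_i b_i = τ q_i / a_i` at `t = 0`, so `F = τ · avg(q/a)`. Thus `F` vanishes at the
origin, and its slope in `τ` there is `avg(q q̃)`, since `1/a_i = q̃_i` at `τ = 0`. The density
involves `F'`, so the solution must be differentiated: `differenceMap` gives an exact linear
equation for difference quotients, and its injectivity at a solution is the linearized maximum
principle. This yields derivatives on `[0, ρ(V))` and their continuity at `0`. A Cauchy-Schwarz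
argument (`IsPosSol.sum_deriv_nonpos`) gives `F' ≥ 0`, so the density defines a probability measure;
rotation invariance makes it the only candidate. The mass bound, fed into the Sinkhorn identities,
bounds `q(0)` and `q̃(0)` above and below uniformly in `n`. -/

theorem FullyIndecomposable.transpose (hV : FullyIndecomposable V) : FullyIndecomposable Vᵀ := by
  refine ⟨fun i j => hV.1 j i, fun I J hI hJ h => ?_⟩
  obtain ⟨i, hi, j, hj, hij⟩ := hV.2 J I hJ hI (by omega)
  exact ⟨j, hj, i, hi, hij⟩

/-- The submatrix on `E × Fᶜ` vanishes, so its side lengths add up to less than `n` unless `Fᶜ` is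
empty. This strict expansion is the form in which the hypothesis is used below. -/
theorem FullyIndecomposable.card_lt (hV : FullyIndecomposable V) {E F : Finset (Fin n)}
    (hE : E.Nonempty) (hEF : ∀ i ∈ E, ∀ j, V i j ≠ 0 → j ∈ F) :
    F = Finset.univ ∨ E.card < F.card := by
  by_cases hF : Fᶜ.Nonempty
  · right
    by_contra! hcard
    have hc := Finset.card_compl_add_card F
    rw [Fintype.card_fin] at hc
    obtain ⟨i, hi, j, hj, hij⟩ := hV.2 E Fᶜ hE hF (by omega)
    exact (Finset.mem_compl.1 hj) (hEF i hi j hij)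
  · left
    simpa [Finset.not_nonempty_iff_eq_empty] using hF

theorem FullyIndecomposable.exists_pos (hV : FullyIndecomposable V) (i : Fin n) :
    ∃ j, 0 < V i j := by
  obtain ⟨k, hk, j, -, hij⟩ := hV.2 {i} Finset.univ (by simp) ⟨i, by simp⟩ (by simp)
  obtain rfl := Finset.mem_singleton.1 hk
  exact ⟨j, lt_of_le_of_ne (hV.1 _ _) hij.symm⟩

/-- Otherwise strict expansion in both directions gives `|E| < |F| < |E|`. It turns local
propagation of equality into a global statement, both for uniqueness and for the linearization. -/
theorem FullyIndecomposable.eq_univ_of_closed (hV : FullyIndecomposable V)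
    {E F : Finset (Fin n)} (hEF : ∀ i ∈ E, ∀ j, V i j ≠ 0 → j ∈ F)
    (hFE : ∀ j ∈ F, ∀ i, V i j ≠ 0 → i ∈ E) (hne : E.Nonempty ∨ F.Nonempty) :
    E = Finset.univ ∧ F = Finset.univ := by
  have hE : E.Nonempty := by
    rcases hne with h | ⟨j, hj⟩
    · exact h
    · obtain ⟨i, hi⟩ := hV.transpose.exists_pos j
      exact ⟨i, hFE j hj i (ne_of_gt hi)⟩
  have hF : F.Nonempty := by
    obtain ⟨i, hi⟩ := hE
    obtain ⟨j, hj⟩ := hV.exists_pos i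
    exact ⟨j, hEF i hi j hj.ne'⟩
  have h1 := hV.card_lt hE hEF
  have h2 := hV.transpose.card_lt hF hFE
  have hu : ∀ s t : Finset (Fin n), t = Finset.univ → ¬ t.card < s.card := by
    intro s t ht
    have := Finset.card_le_univ s
    simp only [ht, Finset.card_univ]
    omega
  rcases h1 with h1 | h1 <;> rcases h2 with h2 | h2
  · exact ⟨h2, h1⟩
  · exact absurd h2 (hu _ _ h1)
  · exact absurd h1 (hu _ _ h2)
  · omega

/-! ### Monotonicity of nonnegative matrices -/

theorem mulVec_apply_eq_sum (W : Matrix (Fin n) (Fin n) ℝ) (x : Fin n → ℝ) (i : Fin n) :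
    (W *ᵥ x) i = ∑ j, W i j * x j := rfl

theorem mulVec_le_mulVec (hV : ∀ i j, 0 ≤ V i j) {x y : Fin n → ℝ} (h : ∀ i, x i ≤ y i)
    (i : Fin n) : (V *ᵥ x) i ≤ (V *ᵥ y) i := by
  rw [mulVec_apply_eq_sum, mulVec_apply_eq_sum]
  exact Finset.sum_le_sum fun j _ => mul_le_mul_of_nonneg_left (h j) (hV i j)

theorem mulVec_nonneg (hV : ∀ i j, 0 ≤ V i j) {x : Fin n → ℝ} (h : ∀ i, 0 ≤ x i)
    (i : Fin n) : 0 ≤ (V *ᵥ x) i := by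
  rw [mulVec_apply_eq_sum]
  exact Finset.sum_nonneg fun j _ => mul_nonneg (hV i j) (h j)

theorem le_mulVec (hV : ∀ i j, 0 ≤ V i j) {x : Fin n → ℝ} (h : ∀ i, 0 ≤ x i)
    (i j : Fin n) : V i j * x j ≤ (V *ᵥ x) i :=
  Finset.single_le_sum (f := fun j => V i j * x j) (fun j _ => mul_nonneg (hV i j) (h j))
    (Finset.mem_univ j)

theorem FullyIndecomposable.mulVec_pos (hV : FullyIndecomposable V) {x : Fin n → ℝ}
    (h : ∀ i, 0 < x i) (i : Fin n) : 0 < (V *ᵥ x) i := by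
  obtain ⟨j, hj⟩ := hV.exists_pos i
  exact (mul_pos hj (h j)).trans_le (le_mulVec hV.1 (fun i => (h i).le) i j)

theorem eq_of_mulVec_eq (hV : ∀ i j, 0 ≤ V i j) {x y : Fin n → ℝ} (h : ∀ i, x i ≤ y i)
    {i : Fin n} (he : (V *ᵥ x) i = (V *ᵥ y) i) {j : Fin n} (hij : V i j ≠ 0) : x j = y j := by
  rw [mulVec_apply_eq_sum, mulVec_apply_eq_sum] at he
  have := (Finset.sum_eq_sum_iff_of_le
    (fun j _ => mul_le_mul_of_nonneg_left (h j) (hV i j))).1 he j (Finset.mem_univ j)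
  exact mul_left_cancel₀ hij this

/-! ### Positive solutions of the master equations -/

/-- `p = (q, q̃)` is a positive solution of the master equations, in polynomial form, with
parameters `τ = s²` and `t`. -/
structure IsPosSol (V : Matrix (Fin n) (Fin n) ℝ) (τ t : ℝ)
    (p : (Fin n → ℝ) × (Fin n → ℝ)) : Prop where
  fst_pos : ∀ i, 0 < p.1 i
  snd_pos : ∀ i, 0 < p.2 i
  fst_eq : ∀ i, p.1 i * (τ + ((V *ᵥ p.2) i + t) * ((Vᵀ *ᵥ p.1) i + t)) = (Vᵀ *ᵥ p.1) i + t
  snd_eq : ∀ i, p.2 i * (τ + ((V *ᵥ p.2) i + t) * ((Vᵀ *ᵥ p.1) i + t)) = (V *ᵥ p.2) i + t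
  sum_eq : ∑ i, p.1 i = ∑ i, p.2 i

theorem IsPosSol.swap {τ t : ℝ} {p : (Fin n → ℝ) × (Fin n → ℝ)} (h : IsPosSol V τ t p) :
    IsPosSol Vᵀ τ t p.swap where
  fst_pos := h.snd_pos
  snd_pos := h.fst_pos
  fst_eq i := by
    have := h.snd_eq i
    rw [mul_comm (_ + t)] at this
    simpa using this
  snd_eq i := by
    have := h.fst_eq i
    rw [mul_comm (_ + t)] at this
    simpa using this
  sum_eq := h.sum_eq.symm

/-- The equations say `a(1 - qb) = qτ` and `a'(1 - lam q b') = lam q τ`. If `b < lam b'`, then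
together with `a' ≤ lam a` the second left side is strictly below `lam` times the first, a
contradiction. -/
theorem scalar_rigidity {q a b a' b' τ lam : ℝ} (hq : 0 < q) (ha : 0 < a)
    (hlam : 0 < lam) (ha' : 0 < a') (hτ : 0 ≤ τ) (h : q * (τ + b * a) = a)
    (h' : lam * q * (τ + b' * a') = a') (haa : a' ≤ lam * a) (hbb : b ≤ lam * b') :
    b = lam * b' := by
  by_contra hne
  have hlt : b < lam * b' := lt_of_le_of_ne hbb hne
  have e1 : a' * (1 - lam * q * b') = lam * q * τ := by linear_combination -h'
  have e2 : a * (1 - q * b) = q * τ := by linear_combination -h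
  have h0 : 0 ≤ 1 - lam * q * b' := by
    by_contra! hneg
    have : a' * (1 - lam * q * b') < 0 := mul_neg_of_pos_of_neg ha' hneg
    have : 0 ≤ lam * q * τ := by positivity
    linarith
  have h1 : a' * (1 - lam * q * b') ≤ lam * a * (1 - lam * q * b') :=
    mul_le_mul_of_nonneg_right haa h0
  have h2 : lam * a * (1 - lam * q * b') < lam * a * (1 - q * b) := by
    refine mul_lt_mul_of_pos_left ?_ (by positivity)
    have := mul_lt_mul_of_pos_left hlt hq
    linarith
  have h3 : lam * a * (1 - q * b) = lam * (q * τ) := by rw [← e2]; ring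
  linarith

/-- The right sides are increasing in one variable and decreasing in the other, so `q'/q` is
compared with the inverted ratio `q̃/q̃'`. Equality at the maximal ratio `lam` spreads along nonzero
entries of `V`, leaving only `q' = lam q`, `q̃' = q̃/lam`; the equal sums exclude this scaling. -/
theorem IsPosSol.unique (hV : FullyIndecomposable V) {τ t : ℝ} (hτ : 0 ≤ τ) (ht : 0 ≤ t)
    {p p' : (Fin n → ℝ) × (Fin n → ℝ)} (h : IsPosSol V τ t p) (h' : IsPosSol V τ t p') :
    p' = p := by
  rcases isEmpty_or_nonempty (Fin n) with hn | hn
  · exact Subsingleton.elim _ _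
  obtain ⟨m, -, hm⟩ := Finset.exists_max_image (Finset.univ : Finset (Fin n ⊕ Fin n))
    (Sum.elim (fun i => p'.1 i / p.1 i) (fun i => p.2 i / p'.2 i))
    ⟨Sum.inl hn.some, Finset.mem_univ _⟩
  set lam := Sum.elim (fun i => p'.1 i / p.1 i) (fun i => p.2 i / p'.2 i) m with hlamdef
  have hq : ∀ i, p'.1 i ≤ lam * p.1 i := fun i =>
    (div_le_iff₀ (h.fst_pos i)).1 (hm (Sum.inl i) (Finset.mem_univ _))
  have hqt : ∀ i, p.2 i ≤ lam * p'.2 i := fun i =>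
    (div_le_iff₀ (h'.snd_pos i)).1 (hm (Sum.inr i) (Finset.mem_univ _))
  have hS : 0 < ∑ i, p.1 i := Finset.sum_pos (fun i _ => h.fst_pos i) Finset.univ_nonempty
  have hS' : 0 < ∑ i, p'.1 i := Finset.sum_pos (fun i _ => h'.fst_pos i) Finset.univ_nonempty
  have hs1 : ∑ i, p'.1 i ≤ lam * ∑ i, p.1 i := by
    rw [Finset.mul_sum]; exact Finset.sum_le_sum fun i _ => hq i
  have hs2 : ∑ i, p.1 i ≤ lam * ∑ i, p'.1 i := by
    rw [h.sum_eq, h'.sum_eq, Finset.mul_sum]; exact Finset.sum_le_sum fun i _ => hqt i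
  have hlam0 : 0 < lam := by
    by_contra! hneg
    have := mul_nonpos_of_nonpos_of_nonneg hneg hS.le
    linarith
  -- Needed for `t ≤ lam * t`, so that the comparison survives adding the regularization.
  have hlam : 1 ≤ lam := by
    by_contra! hlt
    have h1 : lam * ∑ i, p.1 i < ∑ i, p.1 i := by nlinarith
    have h2 : lam * ∑ i, p'.1 i < ∑ i, p'.1 i := by nlinarith
    linarith
  have htl : t ≤ lam * t := by nlinarith
  have hA : ∀ i, (Vᵀ *ᵥ p'.1) i ≤ lam * (Vᵀ *ᵥ p.1) i := fun i => by
    have := mulVec_le_mulVec (V := Vᵀ) (fun i j => hV.1 j i) (y := lam • p.1) hq i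
    rwa [Matrix.mulVec_smul] at this
  have hB : ∀ i, (V *ᵥ p.2) i ≤ lam * (V *ᵥ p'.2) i := fun i => by
    have := mulVec_le_mulVec hV.1 (y := lam • p'.2) hqt i
    rwa [Matrix.mulVec_smul] at this
  have posA : ∀ i, 0 < (Vᵀ *ᵥ p.1) i := hV.transpose.mulVec_pos h.fst_pos
  have posA' : ∀ i, 0 < (Vᵀ *ᵥ p'.1) i := hV.transpose.mulVec_pos h'.fst_pos
  have posB : ∀ i, 0 < (V *ᵥ p.2) i := hV.mulVec_pos h.snd_pos
  have posB' : ∀ i, 0 < (V *ᵥ p'.2) i := hV.mulVec_pos h'.snd_pos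
  have hE : ∀ i, p'.1 i = lam * p.1 i → ∀ j, V i j ≠ 0 → p.2 j = lam * p'.2 j := by
    intro i hi j hij
    have e := scalar_rigidity (h.fst_pos i) (add_pos_of_pos_of_nonneg (posA i) ht) hlam0
      (add_pos_of_pos_of_nonneg (posA' i) ht) hτ (h.fst_eq i) (hi ▸ h'.fst_eq i)
      (by linarith [hA i]) (by linarith [hB i])
    refine eq_of_mulVec_eq hV.1 (y := lam • p'.2) hqt (i := i) ?_ hij
    rw [Matrix.mulVec_smul, Pi.smul_apply, smul_eq_mul]
    linarith [hB i]
  have hF : ∀ j, p.2 j = lam * p'.2 j → ∀ i, V i j ≠ 0 → p'.1 i = lam * p.1 i := by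
    intro j hj i hij
    have e1 := h'.snd_eq j
    have e2 := h.snd_eq j
    rw [mul_comm (_ + t)] at e1 e2
    have e := scalar_rigidity (h'.snd_pos j) (add_pos_of_pos_of_nonneg (posB' j) ht) hlam0
      (add_pos_of_pos_of_nonneg (posB j) ht) hτ e1 (hj ▸ e2) (by linarith [hB j])
      (by linarith [hA j])
    refine eq_of_mulVec_eq (V := Vᵀ) (fun i j => hV.1 j i) (y := lam • p.1) hq (i := j) ?_ hij
    rw [Matrix.mulVec_smul, Pi.smul_apply, smul_eq_mul]
    linarith [hA j]
  classical
  have key := hV.eq_univ_of_closed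
    (E := Finset.univ.filter fun i => p'.1 i = lam * p.1 i)
    (F := Finset.univ.filter fun i => p.2 i = lam * p'.2 i)
    (fun i hi j hij => by simpa using hE i (by simpa using hi) j hij)
    (fun j hj i hij => by simpa using hF j (by simpa using hj) i hij) (by
      rcases m with m | m
      · refine Or.inl ⟨m, ?_⟩
        simp [hlamdef, div_mul_cancel₀ _ (h.fst_pos m).ne']
      · refine Or.inr ⟨m, ?_⟩
        simp [hlamdef, div_mul_cancel₀ _ (h'.snd_pos m).ne'])
  simp only [Finset.filter_eq_self, Finset.mem_univ, true_imp_iff] at key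
  obtain ⟨k1, k2⟩ := key
  have hs3 : ∑ i, p'.1 i = lam * ∑ i, p.1 i := by
    rw [Finset.mul_sum]; exact Finset.sum_congr rfl fun i _ => k1 i
  have hs4 : ∑ i, p.1 i = lam * ∑ i, p'.1 i := by
    rw [h.sum_eq, h'.sum_eq, Finset.mul_sum]; exact Finset.sum_congr rfl fun i _ => k2 i
  have h1 : lam = 1 := by nlinarith
  ext i
  · simpa [h1] using k1 i
  · simpa [h1] using (k2 i).symm

/-- `p = (q, q̃)` is a nonnegative solution of the master equations, in polynomial form, with
parameters `τ = s²` and `t = 0`. -/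
structure IsNonnegSol (V : Matrix (Fin n) (Fin n) ℝ) (τ : ℝ)
    (p : (Fin n → ℝ) × (Fin n → ℝ)) : Prop where
  fst_nonneg : ∀ i, 0 ≤ p.1 i
  snd_nonneg : ∀ i, 0 ≤ p.2 i
  fst_eq : ∀ i, p.1 i * (τ + (V *ᵥ p.2) i * (Vᵀ *ᵥ p.1) i) = (Vᵀ *ᵥ p.1) i
  snd_eq : ∀ i, p.2 i * (τ + (V *ᵥ p.2) i * (Vᵀ *ᵥ p.1) i) = (V *ᵥ p.2) i
  sum_eq : ∑ i, p.1 i = ∑ i, p.2 i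

theorem IsNonnegSol.swap {τ : ℝ} {p : (Fin n → ℝ) × (Fin n → ℝ)} (h : IsNonnegSol V τ p) :
    IsNonnegSol Vᵀ τ p.swap where
  fst_nonneg := h.snd_nonneg
  snd_nonneg := h.fst_nonneg
  fst_eq i := by
    have := h.snd_eq i
    rw [mul_comm ((V *ᵥ p.2) i)] at this
    simpa using this
  snd_eq i := by
    have := h.fst_eq i
    rw [mul_comm ((V *ᵥ p.2) i)] at this
    simpa using this
  sum_eq := h.sum_eq.symm

/-- The support of `q` is closed under the directed graph of `V`; a nonempty closed set cannot
expand strictly, hence it is everything. -/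
theorem IsNonnegSol.fst_pos (hV : FullyIndecomposable V) {τ : ℝ}
    {p : (Fin n → ℝ) × (Fin n → ℝ)} (h : IsNonnegSol V τ p) (hp : p.1 ≠ 0) (i : Fin n) :
    0 < p.1 i := by
  classical
  have hcl : ∀ i, p.1 i ≠ 0 → ∀ j, V i j ≠ 0 → p.1 j ≠ 0 := by
    intro i hi j hij hj
    have h1 := h.fst_eq j
    rw [hj, zero_mul] at h1
    have h2 := le_mulVec (V := Vᵀ) (fun i j => hV.1 j i) h.fst_nonneg j i
    rw [← h1, Matrix.transpose_apply] at h2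
    have h3 : 0 < V i j * p.1 i :=
      mul_pos (lt_of_le_of_ne (hV.1 _ _) hij.symm) (lt_of_le_of_ne (h.fst_nonneg _) hi.symm)
    linarith
  have key := hV.card_lt (E := Finset.univ.filter fun i => p.1 i ≠ 0)
    (F := Finset.univ.filter fun i => p.1 i ≠ 0) (by
      obtain ⟨i, hi⟩ := Function.ne_iff.1 hp
      exact ⟨i, by simpa using hi⟩)
    (fun i hi j hij => by simpa using hcl i (by simpa using hi) j hij)
  simp only [lt_self_iff_false, or_false, Finset.filter_eq_self, Finset.mem_univ,
    true_imp_iff] at key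
  exact lt_of_le_of_ne (h.fst_nonneg i) (key i).symm

theorem IsNonnegSol.isPosSol (hV : FullyIndecomposable V) {τ : ℝ}
    {p : (Fin n → ℝ) × (Fin n → ℝ)} (h : IsNonnegSol V τ p) (hp : p ≠ 0) :
    IsPosSol V τ 0 p := by
  -- Equal sums of nonnegative entries prevent exactly one of the two vectors from vanishing.
  have aux : p.1 = 0 ↔ p.2 = 0 := by
    have e1 := Finset.sum_eq_zero_iff_of_nonneg (s := Finset.univ) (f := p.1)
      (fun i _ => h.fst_nonneg i)
    have e2 := Finset.sum_eq_zero_iff_of_nonneg (s := Finset.univ) (f := p.2)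
      (fun i _ => h.snd_nonneg i)
    simp only [funext_iff, Pi.zero_apply]
    simp only [Finset.mem_univ, true_imp_iff] at e1 e2
    rw [← e1, ← e2, h.sum_eq]
  have h1 : p.1 ≠ 0 := fun h0 => hp (Prod.ext h0 (aux.1 h0))
  have h2 : p.2 ≠ 0 := fun h0 => h1 (aux.2 h0)
  exact ⟨h.fst_pos hV h1, h.swap.fst_pos hV.transpose h2, by simpa using h.fst_eq,
    by simpa using h.snd_eq, h.sum_eq⟩

theorem IsPosSol.isNonnegSol {τ : ℝ} {p : (Fin n → ℝ) × (Fin n → ℝ)} (h : IsPosSol V τ 0 p) :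
    IsNonnegSol V τ p :=
  ⟨fun i => (h.fst_pos i).le, fun i => (h.snd_pos i).le, by simpa using h.fst_eq,
    by simpa using h.snd_eq, h.sum_eq⟩

/-! ### The Perron eigenvector -/

theorem pow_mulVec_nonneg (hV : ∀ i j, 0 ≤ V i j) {x : Fin n → ℝ} (hx : ∀ i, 0 ≤ x i) (k : ℕ)
    (i : Fin n) : 0 ≤ (V ^ k *ᵥ x) i := by
  induction k generalizing i with
  | zero => simpa using hx i
  | succ k ih =>
    rw [pow_succ', ← Matrix.mulVec_mulVec]
    exact mulVec_nonneg hV ih i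

/-- Each application of `V` adds at least one index to the support until it is full. -/
theorem FullyIndecomposable.card_support_pow_mulVec (hV : FullyIndecomposable V)
    {x : Fin n → ℝ} (hx : ∀ i, 0 ≤ x i) (hx0 : x ≠ 0) (k : ℕ) :
    min n (k + 1) ≤ (Finset.univ.filter fun i => (V ^ k *ᵥ x) i ≠ 0).card := by
  have hn : 0 < n := by
    obtain ⟨i, -⟩ := Function.ne_iff.1 hx0
    exact i.pos
  induction k with
  | zero =>
    obtain ⟨i, hi⟩ := Function.ne_iff.1 hx0
    refine (min_le_right _ _).trans (Finset.card_pos.2 ⟨i, ?_⟩)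
    simpa using hi
  | succ k ih =>
    have hne : (Finset.univ.filter fun i => (V ^ k *ᵥ x) i ≠ 0).Nonempty := by
      rw [← Finset.card_pos]
      omega
    have hcl : ∀ i ∈ Finset.univ.filter fun i => (V ^ k *ᵥ x) i ≠ 0, ∀ j, Vᵀ i j ≠ 0 →
        j ∈ Finset.univ.filter fun i => (V ^ (k + 1) *ᵥ x) i ≠ 0 := by
      intro i hi j hij
      simp only [Finset.mem_filter, Finset.mem_univ, true_and] at hi ⊢
      rw [pow_succ', ← Matrix.mulVec_mulVec]
      have h1 := le_mulVec hV.1 (pow_mulVec_nonneg hV.1 hx k) j i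
      have h2 : 0 < V j i * (V ^ k *ᵥ x) i :=
        mul_pos (lt_of_le_of_ne (hV.1 _ _) (Ne.symm hij))
          (lt_of_le_of_ne (pow_mulVec_nonneg hV.1 hx k i) hi.symm)
      exact (h2.trans_le h1).ne'
    rcases hV.transpose.card_lt hne hcl with h | h
    · rw [h, Finset.card_univ, Fintype.card_fin]
      exact min_le_left _ _
    · omega

theorem FullyIndecomposable.pow_mulVec_pos (hV : FullyIndecomposable V)
    {x : Fin n → ℝ} (hx : ∀ i, 0 ≤ x i) (hx0 : x ≠ 0) (i : Fin n) : 0 < (V ^ n *ᵥ x) i := by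
  have h := hV.card_support_pow_mulVec hx hx0 n
  have h2 : (Finset.univ.filter fun i => (V ^ n *ᵥ x) i ≠ 0) = Finset.univ := by
    apply Finset.eq_univ_of_card
    have := Finset.card_le_univ (Finset.univ.filter fun i => (V ^ n *ᵥ x) i ≠ 0)
    rw [Fintype.card_fin] at *
    omega
  have h3 : i ∈ Finset.univ.filter fun i => (V ^ n *ᵥ x) i ≠ 0 := by
    rw [h2]
    exact Finset.mem_univ i
  exact lt_of_le_of_ne (pow_mulVec_nonneg hV.1 hx n i) (Finset.mem_filter.1 h3).2.symm

/-- The Collatz-Wielandt problem: on the simplex, `r x ≤ V x` cuts out a compact set of pairs `(r,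
x)`, on which `r` attains its maximum. -/
theorem exists_max_collatzWielandt [Nonempty (Fin n)] (hV : ∀ i j, 0 ≤ V i j) :
    ∃ (r : ℝ) (x : Fin n → ℝ), 0 ≤ r ∧ (∀ i, 0 ≤ x i) ∧ x ≠ 0 ∧
      (∀ i, r * x i ≤ (V *ᵥ x) i) ∧
      ∀ (r' : ℝ) (y : Fin n → ℝ), 0 ≤ r' → (∀ i, 0 < y i) → (∀ i, r' * y i ≤ (V *ᵥ y) i) →
        r' ≤ r := by
  let S : Set (ℝ × (Fin n → ℝ)) :=
    {z | 0 ≤ z.1 ∧ (∀ i, 0 ≤ z.2 i) ∧ ∑ i, z.2 i = 1 ∧ ∀ i, z.1 * z.2 i ≤ (V *ᵥ z.2) i}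
  have hclosed : IsClosed S := by
    have hc : ∀ i, Continuous fun z : ℝ × (Fin n → ℝ) => (V *ᵥ z.2) i := fun i => by
      simp only [mulVec_apply_eq_sum]
      fun_prop
    refine (isClosed_le continuous_const continuous_fst).inter
      (IsClosed.inter ?_ (IsClosed.inter (isClosed_eq (by fun_prop) continuous_const) ?_))
    · change IsClosed {z : ℝ × (Fin n → ℝ) | ∀ i, 0 ≤ z.2 i}
      rw [Set.ofPred_forall]
      exact isClosed_iInter fun i => isClosed_le continuous_const (by fun_prop)
    · change IsClosed {z : ℝ × (Fin n → ℝ) | ∀ i, z.1 * z.2 i ≤ (V *ᵥ z.2) i}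
      rw [Set.ofPred_forall]
      exact isClosed_iInter fun i => isClosed_le (by fun_prop) (hc i)
  have hsub : S ⊆ Icc (0, 0) (∑ i, ∑ j, V i j, 1) := by
    rintro ⟨r, x⟩ ⟨h1, h2, h3, h4⟩
    have hx1 : ∀ i, x i ≤ 1 := fun i =>
      (Finset.single_le_sum (fun j _ => h2 j) (Finset.mem_univ i)).trans_eq h3
    refine ⟨⟨h1, h2⟩, ?_, hx1⟩
    calc r = ∑ i, r * x i := by rw [← Finset.mul_sum, h3, mul_one]
      _ ≤ ∑ i, (V *ᵥ x) i := Finset.sum_le_sum fun i _ => h4 i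
      _ ≤ ∑ i, ∑ j, V i j := Finset.sum_le_sum fun i _ => by
          rw [mulVec_apply_eq_sum]
          exact Finset.sum_le_sum fun j _ => mul_le_of_le_one_right (hV i j) (hx1 j)
  have hcomp : IsCompact S := isCompact_Icc.of_isClosed_subset hclosed hsub
  have hne : S.Nonempty := by
    obtain ⟨k⟩ := ‹Nonempty (Fin n)›
    have h0 : ∀ i, 0 ≤ (Pi.single k 1 : Fin n → ℝ) i := fun i => by
      by_cases h : i = k
      · subst h; simp
      · simp [h]
    exact ⟨(0, Pi.single k 1), le_rfl, h0, by simp, fun i => by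
      simpa using mulVec_nonneg hV h0 i⟩
  obtain ⟨⟨r, x⟩, ⟨h1, h2, h3, h4⟩, hmax⟩ := hcomp.exists_isMaxOn hne continuous_fst.continuousOn
  refine ⟨r, x, h1, h2, ?_, h4, fun r' y hr' hy hle => ?_⟩
  · rintro rfl
    simp at h3
  · have hs : 0 < ∑ i, y i := Finset.sum_pos (fun i _ => hy i) Finset.univ_nonempty
    refine hmax (a := (r', (∑ i, y i)⁻¹ • y)) ⟨hr', fun i => ?_, ?_, fun i => ?_⟩
    · have := (hy i).le
      simp only [Pi.smul_apply, smul_eq_mul]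
      positivity
    · simp only [Pi.smul_apply, smul_eq_mul]
      rw [← Finset.mul_sum, inv_mul_cancel₀ hs.ne']
    · rw [Matrix.mulVec_smul]
      simp only [Pi.smul_apply, smul_eq_mul]
      rw [mul_left_comm]
      exact mul_le_mul_of_nonneg_left (hle i) (inv_nonneg.2 hs.le)

/-- If the maximizer had a nonzero defect `Vx - rx`, then `y = Vⁿx` would have the strictly positive
defect `Vⁿ(Vx - rx)`, which leaves room for a larger `r`. -/
theorem FullyIndecomposable.exists_pos_eigenvector [Nonempty (Fin n)]
    (hV : FullyIndecomposable V) :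
    ∃ (r : ℝ) (w : Fin n → ℝ), 0 < r ∧ (∀ i, 0 < w i) ∧ V *ᵥ w = r • w := by
  obtain ⟨r, x, hr, hx, hx0, hle, hmax⟩ := exists_max_collatzWielandt hV.1
  have hcomm : ∀ z, V *ᵥ (V ^ n *ᵥ z) = V ^ n *ᵥ (V *ᵥ z) := fun z => by
    rw [Matrix.mulVec_mulVec, Matrix.mulVec_mulVec, ← pow_succ, ← pow_succ']
  have heig : V *ᵥ x = r • x := by
    by_contra hne
    set d := V *ᵥ x - r • x with hd
    have hd0 : ∀ i, 0 ≤ d i := fun i => by simpa [hd] using hle i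
    have hdpos := hV.pow_mulVec_pos hd0 (sub_ne_zero.2 hne)
    have hypos := hV.pow_mulVec_pos hx hx0
    set y := V ^ n *ᵥ x with hy
    have hVy : V *ᵥ y = r • y + V ^ n *ᵥ d := by
      rw [hd, Matrix.mulVec_sub, Matrix.mulVec_smul, hy, hcomm]
      abel
    obtain ⟨m, -, hm⟩ := Finset.exists_min_image Finset.univ
      (fun i => (V ^ n *ᵥ d) i / y i) Finset.univ_nonempty
    have hε : 0 < (V ^ n *ᵥ d) m / y m := div_pos (hdpos m) (hypos m)
    have := hmax (r + (V ^ n *ᵥ d) m / y m) y (by positivity) hypos fun i => by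
      have h1 := (le_div_iff₀ (hypos i)).1 (hm i (Finset.mem_univ i))
      rw [hVy, Pi.add_apply, Pi.smul_apply, smul_eq_mul, add_mul]
      linarith
    linarith
  have hpow : ∀ k : ℕ, V ^ k *ᵥ x = r ^ k • x := by
    intro k
    induction k with
    | zero => simp
    | succ k ih =>
      rw [pow_succ', ← Matrix.mulVec_mulVec, ih, Matrix.mulVec_smul, heig, smul_smul, pow_succ]
  have hxpos : ∀ i, 0 < x i := fun i => by
    have h := hV.pow_mulVec_pos hx hx0 i
    rw [hpow n] at h
    exact lt_of_le_of_ne (hx i) fun h0 => by simp [← h0] at h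
  refine ⟨r, x, ?_, hxpos, heig⟩
  obtain ⟨i⟩ := ‹Nonempty (Fin n)›
  have h := hV.mulVec_pos hxpos i
  rw [heig] at h
  exact lt_of_le_of_ne hr fun h0 => by simp [← h0] at h

theorem mem_spectrum_iff_exists_mulVec_eq (M : Matrix (Fin n) (Fin n) ℂ) (k : ℂ) :
    k ∈ spectrum ℂ M ↔ ∃ v, v ≠ 0 ∧ M *ᵥ v = k • v := by
  rw [spectrum.mem_iff, Matrix.isUnit_iff_isUnit_det, isUnit_iff_ne_zero, not_not,
    ← Matrix.exists_mulVec_eq_zero_iff]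
  refine exists_congr fun v => and_congr_right fun _ => ?_
  rw [Matrix.sub_mulVec, Algebra.algebraMap_eq_smul_one, Matrix.smul_mulVec, Matrix.one_mulVec,
    sub_eq_zero, eq_comm]

/-- `r` is itself an eigenvalue. Any other eigenvalue is bounded by evaluating its equation at the
index where `|v_i| / w_i` is largest. -/
theorem rho_eq_of_pos_eigenvector [Nonempty (Fin n)] (hV : ∀ i j, 0 ≤ V i j) {r : ℝ}
    {w : Fin n → ℝ} (hr : 0 < r) (hw : ∀ i, 0 < w i) (h : V *ᵥ w = r • w) : rho V = r := by
  have key : spectralRadius ℂ (V.map (algebraMap ℝ ℂ)) = ENNReal.ofReal r := by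
    apply le_antisymm
    · refine iSup₂_le fun k hk => ?_
      obtain ⟨v, hv0, hv⟩ := (mem_spectrum_iff_exists_mulVec_eq _ _).1 hk
      rw [← ENNReal.ofReal_coe_nnreal, coe_nnnorm]
      apply ENNReal.ofReal_le_ofReal
      obtain ⟨m, -, hm⟩ := Finset.exists_max_image Finset.univ
        (fun i => ‖v i‖ / w i) Finset.univ_nonempty
      set c := ‖v m‖ / w m with hc
      have hle : ∀ i, ‖v i‖ ≤ c * w i := fun i =>
        (div_le_iff₀ (hw i)).1 (hm i (Finset.mem_univ i))
      have hcpos : 0 < c := by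
        obtain ⟨i, hi⟩ := Function.ne_iff.1 hv0
        have : 0 < ‖v i‖ := norm_pos_iff.2 hi
        exact pos_of_mul_pos_left (this.trans_le (hle i)) (hw i).le
      have hvm : ‖v m‖ = c * w m := by rw [hc, div_mul_cancel₀ _ (hw m).ne']
      have h1 : ‖k‖ * (c * w m) ≤ r * (c * w m) := by
        calc ‖k‖ * (c * w m) = ‖(k • v) m‖ := by rw [Pi.smul_apply, norm_smul, hvm]
          _ = ‖∑ j, (V m j : ℂ) * v j‖ := by rw [← hv]; rfl
          _ ≤ ∑ j, ‖(V m j : ℂ) * v j‖ := norm_sum_le _ _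
          _ ≤ ∑ j, c * (V m j * w j) := Finset.sum_le_sum fun j _ => by
              rw [norm_mul, Complex.norm_real, Real.norm_of_nonneg (hV m j)]
              have := mul_le_mul_of_nonneg_left (hle j) (hV m j)
              linarith
          _ = c * (V *ᵥ w) m := by rw [← Finset.mul_sum]; rfl
          _ = r * (c * w m) := by rw [h, Pi.smul_apply, smul_eq_mul]; ring
      exact le_of_mul_le_mul_right h1 (mul_pos hcpos (hw m))
    · have hmem : (r : ℂ) ∈ spectrum ℂ (V.map (algebraMap ℝ ℂ)) := by
        rw [mem_spectrum_iff_exists_mulVec_eq]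
        refine ⟨fun i => (w i : ℂ), fun h0 => ?_, ?_⟩
        · obtain ⟨i⟩ := ‹Nonempty (Fin n)›
          have := congrFun h0 i
          simp [(hw i).ne'] at this
        · ext i
          have h1 := congrFun h i
          rw [mulVec_apply_eq_sum] at h1
          have h2 := congrArg (algebraMap ℝ ℂ) h1
          simpa [Matrix.mulVec, dotProduct] using h2
      refine le_trans ?_ (le_iSup₂ (f := fun (k : ℂ) (_ : k ∈ spectrum ℂ
        (V.map (algebraMap ℝ ℂ))) => (‖k‖₊ : ENNReal)) (r : ℂ) hmem)
      rw [← ENNReal.ofReal_coe_nnreal, coe_nnnorm, Complex.norm_real, Real.norm_of_nonneg hr.le]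
  rw [rho, key, ENNReal.toReal_ofReal hr.le]

theorem FullyIndecomposable.rho_pos_and_exists_eigenvector [Nonempty (Fin n)]
    (hV : FullyIndecomposable V) :
    0 < rho V ∧ ∃ w : Fin n → ℝ, (∀ i, 0 < w i) ∧ V *ᵥ w = rho V • w := by
  obtain ⟨r, w, hr, hw, h⟩ := hV.exists_pos_eigenvector
  rw [rho_eq_of_pos_eigenvector hV.1 hr hw h]
  exact ⟨hr, w, hw, h⟩

/-! ### The regularized master equations -/

theorem sum_mul_mulVec (W : Matrix (Fin n) (Fin n) ℝ) (x y : Fin n → ℝ) :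
    ∑ i, x i * (W *ᵥ y) i = ∑ i, y i * (Wᵀ *ᵥ x) i := by
  simp only [mulVec_apply_eq_sum, Finset.mul_sum, Matrix.transpose_apply]
  rw [Finset.sum_comm]
  exact Finset.sum_congr rfl fun i _ => Finset.sum_congr rfl fun j _ => by ring

/-- For `t > 0` the equal sums are automatic: summing `q_i b_i = q̃_i a_i`, the terms with `V`
cancel by duality and `t ∑ q = t ∑ q̃` remains. -/
theorem isPosSol_of_eq {τ t : ℝ} (ht : 0 < t) {p : (Fin n → ℝ) × (Fin n → ℝ)}
    (h1 : ∀ i, 0 < p.1 i) (h2 : ∀ i, 0 < p.2 i)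
    (e1 : ∀ i, p.1 i * (τ + ((V *ᵥ p.2) i + t) * ((Vᵀ *ᵥ p.1) i + t)) = (Vᵀ *ᵥ p.1) i + t)
    (e2 : ∀ i, p.2 i * (τ + ((V *ᵥ p.2) i + t) * ((Vᵀ *ᵥ p.1) i + t)) = (V *ᵥ p.2) i + t) :
    IsPosSol V τ t p := by
  refine ⟨h1, h2, e1, e2, ?_⟩
  have key : ∑ i, p.1 i * ((V *ᵥ p.2) i + t) = ∑ i, p.2 i * ((Vᵀ *ᵥ p.1) i + t) := by
    refine Finset.sum_congr rfl fun i _ => ?_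
    linear_combination p.2 i * e1 i - p.1 i * e2 i
  simp only [mul_add, Finset.sum_add_distrib] at key
  rw [sum_mul_mulVec, ← Finset.sum_mul, ← Finset.sum_mul] at key
  exact mul_right_cancel₀ ht.ne' (add_left_cancel key)

theorem resolvent_mono {τ a b a' b' : ℝ} (hτ : 0 ≤ τ) (ha : 0 < a) (hb' : 0 < b')
    (haa : a ≤ a') (hbb : b' ≤ b) : a / (τ + b * a) ≤ a' / (τ + b' * a') := by
  have ha' := ha.trans_le haa
  have hb := hb'.trans_le hbb
  rw [div_le_div_iff₀ (by positivity) (by positivity)]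
  have h1 := mul_le_mul_of_nonneg_right haa hτ
  have h2 := mul_le_mul_of_nonneg_right hbb (mul_pos ha ha').le
  linarith

theorem resolvent_mem_Icc {τ a b t : ℝ} (hτ : 0 ≤ τ) (ht : 0 < t) (ha : t ≤ a) (hb : t ≤ b) :
    a / (τ + b * a) ∈ Icc (0 : ℝ) (1 / t) := by
  have ha' := ht.trans_le ha
  have hb' := ht.trans_le hb
  refine ⟨by positivity, ?_⟩
  rw [div_le_div_iff₀ (by positivity) ht]
  have := mul_le_mul_of_nonneg_right hb ha'.le
  linarith

/-- With the order reversed on the second factor, the fixed-point map is monotone on a box, so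
Knaster-Tarski applies. The regularization bounds the box by `1 / t` and makes the fixed point
positive. -/
theorem exists_isPosSol_of_pos (hV : ∀ i j, 0 ≤ V i j) {τ t : ℝ} (hτ : 0 ≤ τ) (ht : 0 < t) :
    ∃ p, IsPosSol V τ t p := by
  -- This makes `Icc 0 (1 / t)` a complete lattice.
  have : Fact ((0 : ℝ) ≤ 1 / t) := ⟨by positivity⟩
  have hVT : ∀ i j, 0 ≤ Vᵀ i j := fun i j => hV j i
  let B := Fin n → Icc (0 : ℝ) (1 / t)
  let a : B → Fin n → ℝ := fun x i => (Vᵀ *ᵥ fun j => (x j : ℝ)) i + t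
  let b : B → Fin n → ℝ := fun x i => (V *ᵥ fun j => (x j : ℝ)) i + t
  have hat : ∀ x i, t ≤ a x i := fun x i =>
    le_add_of_nonneg_left (mulVec_nonneg hVT (fun j => (x j).2.1) i)
  have hbt : ∀ x i, t ≤ b x i := fun x i =>
    le_add_of_nonneg_left (mulVec_nonneg hV (fun j => (x j).2.1) i)
  have ha : ∀ x y : B, x ≤ y → ∀ i, a x i ≤ a y i := fun x y h i =>
    add_le_add_left (mulVec_le_mulVec hVT (fun j => h j) i) t
  have hb : ∀ x y : B, x ≤ y → ∀ i, b x i ≤ b y i := fun x y h i =>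
    add_le_add_left (mulVec_le_mulVec hV (fun j => h j) i) t
  let f : B × Bᵒᵈ →o B × Bᵒᵈ :=
    { toFun := fun z =>
        (fun i => ⟨a z.1 i / (τ + b (OrderDual.ofDual z.2) i * a z.1 i),
            resolvent_mem_Icc hτ ht (hat _ i) (hbt _ i)⟩,
          OrderDual.toDual fun i => ⟨b (OrderDual.ofDual z.2) i /
            (τ + a z.1 i * b (OrderDual.ofDual z.2) i),
            resolvent_mem_Icc hτ ht (hbt _ i) (hat _ i)⟩)
      monotone' := by
        rintro ⟨x, y⟩ ⟨x', y'⟩ ⟨hx, hy⟩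
        refine ⟨fun i => ?_, fun i => ?_⟩
        · exact resolvent_mono hτ (ht.trans_le (hat _ i)) (ht.trans_le (hbt _ i))
            (ha _ _ hx i) (hb _ _ hy i)
        · exact resolvent_mono hτ (ht.trans_le (hbt _ i)) (ht.trans_le (hat _ i))
            (hb _ _ hy i) (ha _ _ hx i) }
  obtain ⟨⟨x, y⟩, hxy⟩ : ∃ z, f z = z := ⟨_, f.map_lfp⟩
  have hx : ∀ i, a x i / (τ + b y i * a x i) = x i := fun i =>
    congrArg Subtype.val (congrFun (congrArg Prod.fst hxy) i)
  have hy : ∀ i, b y i / (τ + a x i * b y i) = (OrderDual.ofDual y i : ℝ) := fun i =>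
    congrArg Subtype.val (congrFun (congrArg Prod.snd hxy) i)
  have pa : ∀ i, 0 < a x i := fun i => ht.trans_le (hat _ i)
  have pb : ∀ i, 0 < b y i := fun i => ht.trans_le (hbt _ i)
  have pD : ∀ i, 0 < τ + b y i * a x i := fun i => by
    have := mul_pos (pb i) (pa i)
    positivity
  refine ⟨(fun i => (x i : ℝ), fun i => (OrderDual.ofDual y i : ℝ)),
    isPosSol_of_eq ht (fun i => ?_) (fun i => ?_) (fun i => ?_) fun i => ?_⟩
  · change 0 < (x i : ℝ)
    rw [← hx]
    exact div_pos (pa i) (pD i)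
  · change 0 < (OrderDual.ofDual y i : ℝ)
    rw [← hy, mul_comm (a x i)]
    exact div_pos (pb i) (pD i)
  · change (x i : ℝ) * (τ + b y i * a x i) = a x i
    rw [← hx, div_mul_cancel₀ _ (pD i).ne']
  · change (OrderDual.ofDual y i : ℝ) * (τ + b y i * a x i) = b y i
    rw [← hy, mul_comm (a x i), div_mul_cancel₀ _ (pD i).ne']

theorem IsRegularizedSolution.isPosSol {s t : ℝ} (ht : 0 < t) (hV : ∀ i j, 0 ≤ V i j)
    {p : (Fin n → ℝ) × (Fin n → ℝ)} (h : IsRegularizedSolution V s t p) :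
    IsPosSol V (s ^ 2) t p := by
  obtain ⟨h1, h2, e1, e2⟩ := h
  have pD : ∀ i, 0 < s ^ 2 + ((V *ᵥ p.2) i + t) * ((Vᵀ *ᵥ p.1) i + t) := fun i => by
    have ha := mulVec_nonneg (V := Vᵀ) (fun i j => hV j i) (fun i => (h1 i).le) i
    have hb := mulVec_nonneg hV (fun i => (h2 i).le) i
    positivity
  refine isPosSol_of_eq ht h1 h2 (fun i => ?_) fun i => ?_
  · exact (eq_div_iff (pD i).ne').1 (e1 i)
  · exact (eq_div_iff (pD i).ne').1 (e2 i)

theorem IsPosSol.isRegularizedSolution {s t : ℝ} (ht : 0 < t) (hV : ∀ i j, 0 ≤ V i j)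
    {p : (Fin n → ℝ) × (Fin n → ℝ)} (h : IsPosSol V (s ^ 2) t p) :
    IsRegularizedSolution V s t p := by
  have pD : ∀ i, 0 < s ^ 2 + ((V *ᵥ p.2) i + t) * ((Vᵀ *ᵥ p.1) i + t) := fun i => by
    have ha := mulVec_nonneg (V := Vᵀ) (fun i j => hV j i) (fun i => (h.fst_pos i).le) i
    have hb := mulVec_nonneg hV (fun i => (h.snd_pos i).le) i
    positivity
  exact ⟨h.fst_pos, h.snd_pos, fun i => (eq_div_iff (pD i).ne').2 (h.fst_eq i),
    fun i => (eq_div_iff (pD i).ne').2 (h.snd_eq i)⟩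

theorem isPosSol_regularizedSolution (hV : ∀ i j, 0 ≤ V i j) (s : ℝ) {t : ℝ} (ht : 0 < t) :
    IsPosSol V (s ^ 2) t (regularizedSolution V s t) := by
  have h : ∃ p, IsRegularizedSolution V s t p := by
    obtain ⟨p, hp⟩ := exists_isPosSol_of_pos hV (sq_nonneg s) ht
    exact ⟨p, hp.isRegularizedSolution ht hV⟩
  rw [regularizedSolution, dif_pos h]
  exact h.choose_spec.isPosSol ht hV

/-! ### A priori bounds -/

/-- `κ` assigns to each index its block; all blocks have `n / K` elements, and `V` dominates the
block pattern `Z`. -/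
structure IsBlockMap {K : ℕ} (φ c : ℝ) (Z : Matrix (Fin K) (Fin K) ℝ)
    (V : Matrix (Fin n) (Fin n) ℝ) (κ : Fin n → Fin K) : Prop where
  fid : FullyIndecomposable Z
  zero_or_one : ∀ i j, Z i j = 0 ∨ Z i j = 1
  card_eq : ∀ k, ((Finset.univ.filter fun x => κ x = k).card : ℝ) = n / K
  nonneg : ∀ x y, 0 ≤ V x y
  lower : ∀ x y, φ / n * Z (κ x) (κ y) ≤ V x y
  upper : ∀ x y, V x y ≤ c / n

theorem BlockFullyIndecomposable.exists_isBlockMap {φ c : ℝ} {K : ℕ}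
    (h : BlockFullyIndecomposable φ K V) (h0 : ∀ x y, 0 ≤ V x y) (hc : ∀ x y, V x y ≤ c / n) :
    ∃ (Z : Matrix (Fin K) (Fin K) ℝ) (κ : Fin n → Fin K), IsBlockMap φ c Z V κ := by
  obtain ⟨Z, hZ, hfid, I, hpart, hcard, hlow⟩ := h
  choose κ hκ huniq using hpart
  refine ⟨Z, κ, hfid, hZ, fun k => ?_, h0, fun x y => hlow _ _ _ (hκ x) _ (hκ y), hc⟩
  rw [← hcard k]
  congr 2
  ext x
  simp only [Finset.mem_filter, Finset.mem_univ, true_and]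
  exact ⟨fun h => h ▸ hκ x, fun h => (huniq x k h).symm⟩

theorem IsBlockMap.transpose {K : ℕ} {φ c : ℝ} {Z : Matrix (Fin K) (Fin K) ℝ} {κ : Fin n → Fin K}
    (h : IsBlockMap φ c Z V κ) : IsBlockMap φ c Zᵀ Vᵀ κ :=
  ⟨h.fid.transpose, fun i j => h.zero_or_one j i, h.card_eq, fun i j => h.nonneg j i,
    fun i j => h.lower j i, fun i j => h.upper j i⟩

theorem IsBlockMap.card_filter_mem {K : ℕ} {φ c : ℝ} {Z : Matrix (Fin K) (Fin K) ℝ}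
    {κ : Fin n → Fin K} (h : IsBlockMap φ c Z V κ) (U : Finset (Fin K)) :
    ((Finset.univ.filter fun x => κ x ∈ U).card : ℝ) = U.card * (n / K) := by
  have : (Finset.univ.filter fun x => κ x ∈ U).card
      = ∑ k ∈ U, (Finset.univ.filter fun x => κ x = k).card := by
    rw [Finset.card_eq_sum_card_fiberwise (f := κ) (t := U)]
    · refine Finset.sum_congr rfl fun k hk => ?_
      congr 1
      ext x
      simp only [Finset.mem_filter, Finset.mem_univ, true_and, and_iff_right_iff_imp]
      rintro rfl
      exact hk
    · intro x hx
      simpa using hx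
  rw [this, Nat.cast_sum, Finset.sum_congr rfl fun k _ => h.card_eq k, Finset.sum_const,
    nsmul_eq_mul]

/-- The blocks have equal size `n / K`, so a set `E` meets at least `|E| K / n` of them; the
condition on `V` reduces to the one on `Z`. -/
theorem IsBlockMap.fullyIndecomposable {K : ℕ} {φ c : ℝ} {Z : Matrix (Fin K) (Fin K) ℝ}
    {κ : Fin n → Fin K} (h : IsBlockMap φ c Z V κ) (hφ : 0 < φ) : FullyIndecomposable V := by
  classical
  refine ⟨h.nonneg, fun I J hI hJ hIJ => ?_⟩
  have hn : (0 : ℝ) < n := by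
    obtain ⟨i, -⟩ := hI
    exact_mod_cast i.pos
  have hK : (0 : ℝ) < K := by
    obtain ⟨i, -⟩ := hI
    exact_mod_cast (κ i).pos
  have hle : ∀ E : Finset (Fin n), (E.card : ℝ) ≤ (E.image κ).card * (n / K) := fun E => by
    rw [← h.card_filter_mem]
    exact_mod_cast Finset.card_le_card fun x hx => by
      simpa using ⟨x, hx, rfl⟩
  have hcard : K ≤ (I.image κ).card + (J.image κ).card := by
    have h1 := hle I
    have h2 := hle J
    have h3 : (n : ℝ) ≤ I.card + J.card := by exact_mod_cast hIJ
    have h4 : (n : ℝ) ≤ ((I.image κ).card + (J.image κ).card) * (n / K) := by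
      rw [add_mul]; linarith
    have h5 : (K : ℝ) * (n / K) = n := by field_simp
    have h6 : (K : ℝ) ≤ (I.image κ).card + (J.image κ).card :=
      le_of_mul_le_mul_right (h5.trans_le h4) (div_pos hn hK)
    exact_mod_cast h6
  obtain ⟨i, hi, j, hj, hij⟩ := h.fid.2 _ _ (hI.image κ) (hJ.image κ) hcard
  obtain ⟨x, hx, rfl⟩ := Finset.mem_image.1 hi
  obtain ⟨y, hy, rfl⟩ := Finset.mem_image.1 hj
  refine ⟨x, hx, y, hy, ne_of_gt ?_⟩
  have h1 := h.lower x y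
  rw [(h.zero_or_one _ _).resolve_left hij, mul_one] at h1
  exact (div_pos hφ hn).trans_le h1

/-- The normalized mass of `f` on the block `k`. -/
def blockMass {K : ℕ} (κ : Fin n → Fin K) (f : Fin n → ℝ) (k : Fin K) : ℝ :=
  (∑ x ∈ Finset.univ.filter fun x => κ x = k, f x) / n

theorem blockMass_nonneg {K : ℕ} (κ : Fin n → Fin K) {f : Fin n → ℝ} (hf : ∀ i, 0 ≤ f i)
    (k : Fin K) : 0 ≤ blockMass κ f k :=
  div_nonneg (Finset.sum_nonneg fun i _ => hf i) (Nat.cast_nonneg _)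

theorem sum_filter_mem_eq_blockMass {K : ℕ} (hn : (0 : ℝ) < n) (κ : Fin n → Fin K)
    (f : Fin n → ℝ) (U : Finset (Fin K)) :
    ∑ x ∈ Finset.univ.filter fun x => κ x ∈ U, f x = n * ∑ k ∈ U, blockMass κ f k := by
  rw [← Finset.sum_fiberwise_of_maps_to (t := U) (g := κ) fun x hx => by simpa using hx,
    Finset.mul_sum]
  refine Finset.sum_congr rfl fun k hk => ?_
  rw [blockMass, mul_div_cancel₀ _ hn.ne']
  refine Finset.sum_congr ?_ fun _ _ => rfl
  ext x
  simp only [Finset.mem_filter, Finset.mem_univ, true_and, and_iff_right_iff_imp]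
  rintro rfl
  exact hk

theorem IsBlockMap.le_mulVec {K : ℕ} {φ c : ℝ} {Z : Matrix (Fin K) (Fin K) ℝ}
    {κ : Fin n → Fin K} (h : IsBlockMap φ c Z V κ) {f : Fin n → ℝ}
    (hf : ∀ i, 0 ≤ f i) {l : Fin K} {x : Fin n} (hZ : Z (κ x) l ≠ 0) :
    φ * blockMass κ f l ≤ (V *ᵥ f) x := by
  rw [blockMass, mulVec_apply_eq_sum, mul_div_left_comm, mul_comm, Finset.mul_sum]
  refine le_trans (Finset.sum_le_sum fun y hy => ?_)
    (Finset.sum_le_sum_of_subset_of_nonneg (Finset.subset_univ _)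
      fun y _ _ => mul_nonneg (h.nonneg x y) (hf y))
  refine mul_le_mul_of_nonneg_right ?_ (hf y)
  have h1 := h.lower x y
  rwa [(Finset.mem_filter.1 hy).2, (h.zero_or_one _ _).resolve_left hZ, mul_one] at h1

theorem IsBlockMap.mulVec_le {K : ℕ} {φ c : ℝ} {Z : Matrix (Fin K) (Fin K) ℝ}
    {κ : Fin n → Fin K} (h : IsBlockMap φ c Z V κ) {f : Fin n → ℝ}
    (hf : ∀ i, 0 ≤ f i) (x : Fin n) : (V *ᵥ f) x ≤ c * ((∑ y, f y) / n) := by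
  rw [mulVec_apply_eq_sum, mul_div_left_comm, mul_comm, Finset.mul_sum]
  exact Finset.sum_le_sum fun y _ => mul_le_mul_of_nonneg_right (h.upper x y) (hf y)

theorem IsPosSol.mul_eq_mul {τ t : ℝ} {p : (Fin n → ℝ) × (Fin n → ℝ)} (h : IsPosSol V τ t p)
    (i : Fin n) : p.1 i * ((V *ᵥ p.2) i + t) = p.2 i * ((Vᵀ *ᵥ p.1) i + t) := by
  linear_combination p.2 i * h.fst_eq i - p.1 i * h.snd_eq i

/-- For `t = 0` this measures how far the Sinkhorn-type identities fail when `τ > 0`. -/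
theorem IsPosSol.one_sub_mul {τ t : ℝ} {p : (Fin n → ℝ) × (Fin n → ℝ)} (h : IsPosSol V τ t p)
    (i : Fin n) : ((Vᵀ *ᵥ p.1) i + t) * (1 - p.2 i * ((Vᵀ *ᵥ p.1) i + t)) = τ * p.1 i := by
  rw [← h.mul_eq_mul]
  linear_combination -h.fst_eq i

theorem IsPosSol.snd_mul_le_one (hV : FullyIndecomposable V) {τ t : ℝ} (hτ : 0 ≤ τ) (ht : 0 ≤ t)
    {p : (Fin n → ℝ) × (Fin n → ℝ)} (h : IsPosSol V τ t p) (i : Fin n) :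
    p.2 i * ((Vᵀ *ᵥ p.1) i + t) ≤ 1 := by
  have h1 := h.one_sub_mul i
  have h2 := hV.transpose.mulVec_pos h.fst_pos i
  by_contra! h3
  have h4 : ((Vᵀ *ᵥ p.1) i + t) * (1 - p.2 i * ((Vᵀ *ᵥ p.1) i + t)) < 0 :=
    mul_neg_of_pos_of_neg (by linarith) (by linarith)
  have h5 := mul_nonneg hτ (h.fst_pos i).le
  linarith

/-- Let `A` be the set of blocks reached from `U` through `Z`, so `|A| ≥ |U| + 1`. On `A` one has `a
= Vᵀq + t ≥ φm`, hence `q̃ ≤ 1/(φm)`, and `x = q̃a` satisfies `1 - x ≤ Rq/(φm)`. Read `q̃_y V_zy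
q_z` as flow from `z` to `y`. What enters `A` from `U` is at most the total of `x` over `U`; what
enters from outside `U`, and the `t` term, is of order `(1 + N)/m`. Since `x ≤ 1` everywhere and `x`
is near `1` on `A \ U`, the surplus of at least `n / K` indices in `A` is impossible unless `m` is
controlled by `1 + N`. -/
theorem IsBlockMap.gap {K : ℕ} {φ c R : ℝ} (hφ : 0 < φ) (hc : 0 ≤ c)
    {Z : Matrix (Fin K) (Fin K) ℝ} {κ : Fin n → Fin K} (h : IsBlockMap φ c Z V κ)
    (hn : (0 : ℝ) < n) {τ t : ℝ}
    (hτ : 0 ≤ τ) (hτR : τ ≤ R) (ht : 0 ≤ t) (ht1 : t ≤ 1) {p : (Fin n → ℝ) × (Fin n → ℝ)}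
    (hp : IsPosSol V τ t p) {U : Finset (Fin K)} (hU : U.Nonempty) (hU' : U ≠ Finset.univ)
    {m N : ℝ} (hm : 0 < m) (hUm : ∀ k ∈ U, m ≤ blockMass κ p.1 k)
    (hUN : ∀ k ∉ U, blockMass κ p.1 k ≤ N) :
    m ≤ K / φ * ((c + R) * K + 1) * (1 + N) := by
  classical
  have hV := h.fullyIndecomposable hφ
  have hK : (0 : ℝ) < K := by
    obtain ⟨i, -⟩ := hU
    exact_mod_cast i.pos
  have hN : 0 ≤ N := by
    obtain ⟨k, hk⟩ : ∃ k, k ∉ U := by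
      by_contra! hall
      exact hU' (Finset.eq_univ_of_forall hall)
    exact (blockMass_nonneg κ (fun i => (hp.fst_pos i).le) k).trans (hUN k hk)
  set A : Finset (Fin K) := Finset.univ.filter fun l => ∃ k ∈ U, Z k l ≠ 0 with hA
  have hcardA : U.card + 1 ≤ A.card := by
    rcases h.fid.card_lt (F := A) hU fun i hi j hij => by
      simpa [hA] using ⟨i, hi, hij⟩ with h1 | h1
    · rw [h1, Finset.card_univ]
      exact Finset.card_lt_univ_of_notMem (Classical.choose_spec
        (by by_contra! hall; exact hU' (Finset.eq_univ_of_forall hall) : ∃ k, k ∉ U))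
    · exact h1
  set SU : Finset (Fin n) := Finset.univ.filter fun x => κ x ∈ U with hSU
  set SA : Finset (Fin n) := Finset.univ.filter fun x => κ x ∈ A with hSA
  set a : Fin n → ℝ := fun y => (Vᵀ *ᵥ p.1) y + t with ha
  set x : Fin n → ℝ := fun y => p.2 y * a y with hx
  have hx1 : ∀ y, x y ≤ 1 := hp.snd_mul_le_one hV hτ ht
  have hlow : ∀ y ∈ SA, φ * m ≤ a y := by
    intro y hy
    obtain ⟨k, hk, hkZ⟩ := (Finset.mem_filter.1 (Finset.mem_filter.1 hy).2).2
    have h1 := h.transpose.le_mulVec (fun i => (hp.fst_pos i).le) (l := k) (x := y) hkZ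
    have h2 := mul_le_mul_of_nonneg_left (hUm k hk) hφ.le
    simp only [ha]
    linarith
  have hφm : 0 < φ * m := mul_pos hφ hm
  have hqSA : ∑ y ∈ SA, p.2 y ≤ n / (φ * m) := by
    have h1 : ∀ y ∈ SA, p.2 y ≤ 1 / (φ * m) := fun y hy => by
      rw [le_div_iff₀ hφm]
      exact (mul_le_mul_of_nonneg_left (hlow y hy) (hp.snd_pos y).le).trans (hx1 y)
    have h2 := Finset.sum_le_card_nsmul _ _ _ h1
    have h3 : (SA.card : ℝ) ≤ n := by
      have := Finset.card_le_univ SA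
      rw [Fintype.card_fin] at this
      exact_mod_cast this
    rw [nsmul_eq_mul, mul_one_div] at h2
    exact h2.trans (div_le_div_of_nonneg_right h3 hφm.le)
  have hqSU : ∑ y ∈ SUᶜ, p.1 y ≤ n * (K * N) := by
    have h1 : SUᶜ = Finset.univ.filter fun x => κ x ∈ Uᶜ := by
      ext y; simp [hSU]
    rw [h1, sum_filter_mem_eq_blockMass hn]
    refine mul_le_mul_of_nonneg_left ?_ hn.le
    have h2 := Finset.sum_le_card_nsmul Uᶜ (blockMass κ p.1) N fun k hk =>
      hUN k (Finset.mem_compl.1 hk)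
    have h3 : ((Uᶜ).card : ℝ) ≤ K := by
      have := Finset.card_le_univ Uᶜ
      rw [Fintype.card_fin] at this
      exact_mod_cast this
    rw [nsmul_eq_mul] at h2
    exact h2.trans (mul_le_mul_of_nonneg_right h3 hN)
  have hqSU0 : 0 ≤ ∑ y ∈ SUᶜ, p.1 y := Finset.sum_nonneg fun y _ => (hp.fst_pos y).le
  have hqSA0 : 0 ≤ ∑ y ∈ SA, p.2 y := Finset.sum_nonneg fun y _ => (hp.snd_pos y).le
  -- Splitting the incoming flow by its source: `SU` contributes at most its own total, its
  -- complement and `t` only error terms.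
  have hflow : ∑ y ∈ SA, x y ≤ ∑ y ∈ SU, x y +
      (c / n * ∑ y ∈ SUᶜ, p.1 y + t) * ∑ y ∈ SA, p.2 y := by
    have e1 : ∑ y ∈ SA, x y = ∑ y ∈ SA, ∑ z ∈ SU, p.2 y * (V z y * p.1 z) +
        ∑ y ∈ SA, ∑ z ∈ SUᶜ, p.2 y * (V z y * p.1 z) + t * ∑ y ∈ SA, p.2 y := by
      rw [Finset.mul_sum, ← Finset.sum_add_distrib, ← Finset.sum_add_distrib]
      refine Finset.sum_congr rfl fun y _ => ?_
      rw [Finset.sum_add_sum_compl, ← Finset.mul_sum]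
      simp only [hx, ha, mulVec_apply_eq_sum, Matrix.transpose_apply]
      ring
    have e2 : ∑ y ∈ SA, ∑ z ∈ SU, p.2 y * (V z y * p.1 z) ≤ ∑ z ∈ SU, x z := by
      rw [Finset.sum_comm]
      refine Finset.sum_le_sum fun z _ => ?_
      have h1 : ∑ y ∈ SA, p.2 y * (V z y * p.1 z) ≤ ∑ y, p.2 y * (V z y * p.1 z) :=
        Finset.sum_le_sum_of_subset_of_nonneg (Finset.subset_univ _) fun y _ _ =>
          mul_nonneg (hp.snd_pos y).le (mul_nonneg (h.nonneg z y) (hp.fst_pos z).le)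
      have h2 : ∑ y, p.2 y * (V z y * p.1 z) = p.1 z * (V *ᵥ p.2) z := by
        rw [mulVec_apply_eq_sum, Finset.mul_sum]
        exact Finset.sum_congr rfl fun y _ => by ring
      have h3 := hp.mul_eq_mul z
      have h4 := mul_nonneg (hp.fst_pos z).le ht
      simp only [hx, ha]
      linarith
    have e3 : ∑ y ∈ SA, ∑ z ∈ SUᶜ, p.2 y * (V z y * p.1 z) ≤
        (c / n * ∑ y ∈ SUᶜ, p.1 y) * ∑ y ∈ SA, p.2 y := by
      rw [Finset.mul_sum]
      refine Finset.sum_le_sum fun y _ => ?_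
      rw [← Finset.mul_sum, mul_comm, Finset.mul_sum SUᶜ]
      refine mul_le_mul_of_nonneg_right (Finset.sum_le_sum fun z _ => ?_) (hp.snd_pos y).le
      exact mul_le_mul_of_nonneg_right (h.upper z y) (hp.fst_pos z).le
    rw [e1, add_mul]
    linarith
  have hdiff := Finset.sum_sdiff_sub_sum_sdiff (s₁ := SU) (s₂ := SA) (f := x)
  have hSUA : ∑ y ∈ SU \ SA, x y ≤ (SU \ SA).card := by
    have := Finset.sum_le_card_nsmul (SU \ SA) x 1 fun y _ => hx1 y
    simpa using this
  -- On `SA \ SU` the defect `1 - x` is small because `a` is large and `q` is controlled by `N`.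
  have hSAU : ((SA \ SU).card : ℝ) - R / (φ * m) * (n * (K * N)) ≤ ∑ y ∈ SA \ SU, x y := by
    have h1 : ∀ y ∈ SA \ SU, 1 - R / (φ * m) * p.1 y ≤ x y := by
      intro y hy
      have h2 := hlow y (Finset.mem_sdiff.1 hy).1
      have h3 := hp.one_sub_mul y
      have h4 : a y * (1 - x y) = τ * p.1 y := h3
      have h5 : φ * m * (1 - x y) ≤ R * p.1 y :=
        calc φ * m * (1 - x y) ≤ a y * (1 - x y) :=
              mul_le_mul_of_nonneg_right h2 (sub_nonneg.2 (hx1 y))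
          _ = τ * p.1 y := h4
          _ ≤ R * p.1 y := mul_le_mul_of_nonneg_right hτR (hp.fst_pos y).le
      have h6 : 1 - x y ≤ R * p.1 y / (φ * m) := by
        rw [le_div_iff₀ hφm]; linarith
      rw [div_mul_eq_mul_div]
      linarith
    have h2 := Finset.sum_le_sum h1
    rw [Finset.sum_sub_distrib, ← Finset.mul_sum] at h2
    have h3 : ∑ y ∈ SA \ SU, p.1 y ≤ n * (K * N) :=
      (Finset.sum_le_sum_of_subset_of_nonneg (fun y hy => by
        simpa using (Finset.mem_sdiff.1 hy).2) fun y _ _ => (hp.fst_pos y).le).trans hqSU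
    have h4 := mul_le_mul_of_nonneg_left h3 (div_nonneg (hτ.trans hτR) hφm.le)
    have h5 : ∑ y ∈ SA \ SU, (1 : ℝ) = (SA \ SU).card := by simp
    linarith
  have hcardS : (n : ℝ) / K ≤ (SA \ SU).card - (SU \ SA).card := by
    have h1 := Finset.sum_sdiff_sub_sum_sdiff (s₁ := SU) (s₂ := SA) (f := fun _ => (1 : ℝ))
    simp only [Finset.sum_const, nsmul_eq_mul, mul_one] at h1
    have h2 := h.card_filter_mem A
    have h3 := h.card_filter_mem U
    have h4 : (U.card : ℝ) + 1 ≤ A.card := by exact_mod_cast hcardA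
    have h5 := mul_le_mul_of_nonneg_right h4 (div_pos hn hK).le
    rw [h1, h2, h3]
    linarith
  have hprod : (c / n * ∑ y ∈ SUᶜ, p.1 y + t) * ∑ y ∈ SA, p.2 y ≤
      (c * K * N + 1) * (n / (φ * m)) := by
    refine mul_le_mul ?_ hqSA hqSA0 (by positivity)
    have h1 := mul_le_mul_of_nonneg_left hqSU (div_nonneg hc hn.le)
    have h2 : c / n * (n * (K * N)) = c * K * N := by field_simp
    linarith
  have hfin : (n : ℝ) / K ≤ (c * K * N + 1) * (n / (φ * m)) + R / (φ * m) * (n * (K * N)) := by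
    linarith
  have hfin2 : (n : ℝ) / K ≤ n / (φ * m) * ((c + R) * K * N + 1) := by
    have e : (c * K * N + 1) * (n / (φ * m)) + R / (φ * m) * (n * (K * N)) =
      n / (φ * m) * ((c + R) * K * N + 1) := by ring
    linarith
  rw [div_mul_eq_mul_div, div_le_div_iff₀ hK hφm] at hfin2
  have hfin3 : φ * m ≤ ((c + R) * K * N + 1) * K := by
    rw [mul_assoc (n : ℝ)] at hfin2
    exact le_of_mul_le_mul_left hfin2 hn
  have hR : 0 ≤ R := hτ.trans hτR
  have hfin4 : m ≤ ((c + R) * K * N + 1) * K / φ := by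
    rw [le_div_iff₀ hφ]; linarith
  refine hfin4.trans ?_
  rw [div_le_iff₀ hφ]
  have e : (K : ℝ) / φ * ((c + R) * K + 1) * (1 + N) * φ = K * ((c + R) * K + 1) * (1 + N) := by
    field_simp
  rw [e]
  have h1 : 0 ≤ (c + R) * K := by positivity
  have h2 : 0 ≤ (K : ℝ) * ((c + R) * K + N) := by positivity
  linarith

/-- The set `W j` of indices within a factor `(D + 1) ^ j` of the maximum of `1 + f` gains an index
at each step: the largest value outside it cannot lie below the gap, so it enters `W (j + 1)`. After
`K` steps nothing is left. -/
theorem le_pow_mul_of_gap {K : ℕ} {f : Fin K → ℝ} (hf : ∀ k, 0 ≤ f k) {D : ℝ} (hD : 0 ≤ D)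
    (hgap : ∀ U : Finset (Fin K), U.Nonempty → U ≠ Finset.univ → ∀ m N : ℝ, 0 < m →
      (∀ k ∈ U, m ≤ f k) → (∀ k ∉ U, f k ≤ N) → m ≤ D * (1 + N)) (k l : Fin K) :
    f k ≤ (D + 1) ^ K * (1 + f l) := by
  classical
  obtain ⟨k₀, -, hk₀⟩ := Finset.exists_max_image Finset.univ f ⟨k, Finset.mem_univ k⟩
  set M := 1 + f k₀ with hM
  let W : ℕ → Finset (Fin K) := fun j => Finset.univ.filter fun k => M ≤ (D + 1) ^ j * (1 + f k)
  have hmemW : ∀ j k, k ∈ W j ↔ M ≤ (D + 1) ^ j * (1 + f k) := fun j k => by simp [W]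
  have hmono : ∀ j, W j ⊆ W (j + 1) := fun j k hk => by
    rw [hmemW] at hk ⊢
    have h1 : 0 ≤ (D + 1) ^ j * (1 + f k) * D := by
      have := hf k
      positivity
    rw [pow_succ]
    linarith
  have hk₀W : ∀ j, k₀ ∈ W j := fun j => by
    rw [hmemW]
    exact le_mul_of_one_le_left (by have := hf k₀; positivity) (one_le_pow₀ (by linarith))
  have hcard : ∀ j, min K (j + 1) ≤ (W j).card := by
    intro j
    induction j with
    | zero => exact (min_le_right _ _).trans (Finset.card_pos.2 ⟨k₀, hk₀W 0⟩)
    | succ j ih =>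
      by_cases hW : W j = Finset.univ
      · have h1 := Finset.card_le_card (hmono j)
        rw [hW, Finset.card_univ, Fintype.card_fin] at h1
        exact (min_le_left _ _).trans h1
      · have hne : (W j)ᶜ.Nonempty := by
          rw [Finset.nonempty_iff_ne_empty, Ne, Finset.compl_eq_empty_iff]
          exact hW
        obtain ⟨l₀, hl₀, hmax⟩ := Finset.exists_max_image (W j)ᶜ f hne
        have hpos : 0 < (D + 1) ^ j := by positivity
        have hl₀W : l₀ ∈ W (j + 1) := by
          rw [hmemW, pow_succ, mul_assoc, ← div_le_iff₀' hpos]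
          have hfl := hf l₀
          have hDf := mul_nonneg hD hfl
          -- This is the level that every value of `f` on `W j` reaches; the gap hypothesis needs it
          -- positive.
          rcases le_or_gt (M / (D + 1) ^ j - 1) 0 with hneg | hmpos
          · linarith
          · have := hgap (W j) ⟨k₀, hk₀W j⟩ hW _ (f l₀) hmpos (fun k hk => by
              rw [hmemW, ← div_le_iff₀' hpos] at hk
              linarith) fun k hk => hmax k (Finset.mem_compl.2 hk)
            linarith
        have hss : W j ⊂ W (j + 1) :=
          Finset.ssubset_iff_subset_ne.2 ⟨hmono j, fun he =>
            Finset.mem_compl.1 hl₀ (he ▸ hl₀W)⟩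
        have := Finset.card_lt_card hss
        omega
  have hWK : W K = Finset.univ := by
    apply Finset.eq_univ_of_card
    have h1 := hcard K
    have h2 := Finset.card_le_univ (W K)
    rw [Fintype.card_fin] at h2 ⊢
    omega
  have h1 : l ∈ W K := hWK ▸ Finset.mem_univ l
  rw [hmemW] at h1
  have h2 := hk₀ k (Finset.mem_univ k)
  linarith

/-- The a priori bound on the normalized mass of a solution. -/
def massBound (K : ℕ) (φ c R : ℝ) : ℝ :=
  K * ((K / φ * ((c + R) * K + 1) + 1) ^ K * (1 + (1 / (φ * K) + 1)))

theorem IsBlockMap.sum_le_of_blockMass_le {K : ℕ} {φ c R : ℝ} (hφ : 0 < φ) (hc : 0 ≤ c)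
    {Z : Matrix (Fin K) (Fin K) ℝ} {κ : Fin n → Fin K} (h : IsBlockMap φ c Z V κ)
    (hn : (0 : ℝ) < n) {τ t : ℝ}
    (hτ : 0 ≤ τ) (hτR : τ ≤ R) (ht : 0 ≤ t) (ht1 : t ≤ 1) {p : (Fin n → ℝ) × (Fin n → ℝ)}
    (hp : IsPosSol V τ t p) {k : Fin K} (hk : blockMass κ p.1 k ≤ 1 / (φ * K) + 1) :
    (∑ i, p.1 i) / n ≤ massBound K φ c R := by
  have hR : 0 ≤ R := hτ.trans hτR
  set D := K / φ * ((c + R) * K + 1) with hD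
  have hD0 : 0 ≤ D := by positivity
  have h0 : ∀ k, 0 ≤ blockMass κ p.1 k := blockMass_nonneg κ fun i => (hp.fst_pos i).le
  have h1 : ∀ l, blockMass κ p.1 l ≤ (D + 1) ^ K * (1 + (1 / (φ * K) + 1)) := fun l =>
    (le_pow_mul_of_gap h0 hD0 (fun U hU hU' m N hm h1 h2 =>
      h.gap hφ hc hn hτ hτR ht ht1 hp hU hU' hm h1 h2) l k).trans
      (mul_le_mul_of_nonneg_left (by linarith) (by positivity))
  have h2 := sum_filter_mem_eq_blockMass hn κ p.1 Finset.univ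
  simp only [Finset.mem_univ, Finset.filter_true] at h2
  rw [h2, mul_div_cancel_left₀ _ hn.ne']
  have h3 := Finset.sum_le_card_nsmul Finset.univ (blockMass κ p.1) _ fun l _ => h1 l
  simpa [massBound] using h3

/-- Across a nonzero entry `(k, l)` of `Z`, the bound `q̃(Vᵀq + t) ≤ 1` forces the product of the
mass of `q` on `k` and of `q̃` on `l` to be at most `1/(φK)`. One factor is therefore bounded, and
the gap estimate carries this to all blocks; transposition and equal sums treat `q̃`. -/
theorem IsBlockMap.sum_le {K : ℕ} {φ c R : ℝ} (hφ : 0 < φ) (hc : 0 ≤ c)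
    {Z : Matrix (Fin K) (Fin K) ℝ} {κ : Fin n → Fin K} (h : IsBlockMap φ c Z V κ)
    (hn : (0 : ℝ) < n) {τ t : ℝ}
    (hτ : 0 ≤ τ) (hτR : τ ≤ R) (ht : 0 ≤ t) (ht1 : t ≤ 1) {p : (Fin n → ℝ) × (Fin n → ℝ)}
    (hp : IsPosSol V τ t p) : (∑ i, p.1 i) / n ≤ massBound K φ c R := by
  have hV := h.fullyIndecomposable hφ
  have hn' : 0 < n := by exact_mod_cast hn
  set k := κ ⟨0, hn'⟩ with hk
  have hK : (0 : ℝ) < K := by exact_mod_cast k.pos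
  obtain ⟨l, hl⟩ := h.fid.exists_pos k
  have hprod : φ * blockMass κ p.1 k * blockMass κ p.2 l ≤ 1 / K := by
    have h1 : ∀ y ∈ Finset.univ.filter fun x => κ x = l,
        φ * blockMass κ p.1 k * p.2 y ≤ 1 := fun y hy => by
      have h2 := h.transpose.le_mulVec (fun i => (hp.fst_pos i).le) (l := k) (x := y)
        (by rw [(Finset.mem_filter.1 hy).2]; exact hl.ne')
      have h3 := hp.snd_mul_le_one hV hτ ht y
      have h4 := mul_le_mul_of_nonneg_right h2 (hp.snd_pos y).le
      have h5 := mul_nonneg (hp.snd_pos y).le ht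
      linarith
    have h2 := Finset.sum_le_card_nsmul _ _ _ h1
    rw [nsmul_eq_mul, mul_one, h.card_eq, ← Finset.mul_sum] at h2
    rw [blockMass.eq_1 κ p.2, ← mul_div_assoc, div_le_iff₀ hn]
    refine h2.trans_eq (by ring)
  by_cases h1 : blockMass κ p.1 k ≤ 1 / (φ * K) + 1
  · exact h.sum_le_of_blockMass_le hφ hc hn hτ hτR ht ht1 hp h1
  by_cases h2 : blockMass κ p.2 l ≤ 1 / (φ * K) + 1
  · rw [hp.sum_eq]
    exact h.transpose.sum_le_of_blockMass_le hφ hc hn hτ hτR ht ht1 hp.swap h2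
  · exfalso
    push Not at h1 h2
    have h3 : 0 < 1 / (φ * K) := by positivity
    have h4 : 1 / (φ * K) < blockMass κ p.1 k * blockMass κ p.2 l := by nlinarith
    rw [div_lt_iff₀ (by positivity)] at h4
    rw [le_div_iff₀ hK] at hprod
    linarith

/-! ### Compactness of the solution set -/

/-- The total mass of the solutions is bounded as long as the parameters stay bounded. -/
def HasMassBound (V : Matrix (Fin n) (Fin n) ℝ) : Prop :=
  ∀ R : ℝ, ∃ B : ℝ, ∀ (τ t : ℝ) (p : (Fin n → ℝ) × (Fin n → ℝ)),
    0 ≤ τ → τ ≤ R → 0 ≤ t → t ≤ 1 → IsPosSol V τ t p → ∑ i, p.1 i ≤ B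

theorem IsBlockMap.hasMassBound {K : ℕ} {φ c : ℝ} (hφ : 0 < φ) (hc : 0 ≤ c)
    {Z : Matrix (Fin K) (Fin K) ℝ} {κ : Fin n → Fin K} (h : IsBlockMap φ c Z V κ)
    (hn : (0 : ℝ) < n) : HasMassBound V := fun R =>
  ⟨massBound K φ c R * n, fun _ _ _ h1 h2 h3 h4 hp =>
    (div_le_iff₀ hn).1 (h.sum_le hφ hc hn h1 h2 h3 h4 hp)⟩

theorem IsPosSol.sum_eigenvector_mul {τ t : ℝ}
    {p : (Fin n → ℝ) × (Fin n → ℝ)} (h : IsPosSol V τ t p) {w : Fin n → ℝ}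
    (hw : V *ᵥ w = rho V • w) :
    ∑ i, w i * p.1 i * (τ + ((V *ᵥ p.2) i + t) * ((Vᵀ *ᵥ p.1) i + t)) =
      rho V * ∑ i, w i * p.1 i + t * ∑ i, w i := by
  have h1 := sum_mul_mulVec V p.1 w
  simp only [hw, Pi.smul_apply, smul_eq_mul] at h1
  have h2 : ∀ i, w i * p.1 i * (τ + ((V *ᵥ p.2) i + t) * ((Vᵀ *ᵥ p.1) i + t)) =
      w i * (Vᵀ *ᵥ p.1) i + t * w i := fun i => by
    rw [mul_assoc, h.fst_eq i]; ring
  simp only [h2, Finset.sum_add_distrib, ← Finset.mul_sum]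
  have h3 : ∑ i, p.1 i * (rho V * w i) = rho V * ∑ i, w i * p.1 i := by
    rw [Finset.mul_sum]
    exact Finset.sum_congr rfl fun i _ => by ring
  rw [← h1, h3]

/-- Paired with the Perron eigenvector, the first equation says that a weighted average of the
denominators is at least `ρ(V)`. This keeps solutions away from zero below the spectral edge. -/
theorem IsPosSol.exists_rho_le [Nonempty (Fin n)] (hV : FullyIndecomposable V) {τ t : ℝ}
    (ht : 0 ≤ t) {p : (Fin n → ℝ) × (Fin n → ℝ)} (h : IsPosSol V τ t p) :
    ∃ i, rho V ≤ τ + ((V *ᵥ p.2) i + t) * ((Vᵀ *ᵥ p.1) i + t) := by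
  obtain ⟨-, w, hw, hVw⟩ := hV.rho_pos_and_exists_eigenvector
  by_contra! hlt
  have h1 := h.sum_eigenvector_mul hVw
  have h2 : ∑ i, w i * p.1 i * (τ + ((V *ᵥ p.2) i + t) * ((Vᵀ *ᵥ p.1) i + t)) <
      ∑ i, w i * p.1 i * rho V := Finset.sum_lt_sum_of_nonempty Finset.univ_nonempty fun i _ =>
    mul_lt_mul_of_pos_left (hlt i) (mul_pos (hw i) (h.fst_pos i))
  rw [← Finset.sum_mul] at h2
  have h3 := mul_nonneg ht (Finset.sum_nonneg fun i (_ : i ∈ Finset.univ) => (hw i).le)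
  linarith

/-- At `t = 0` the weighted average of the denominators equals `ρ(V)`, while each exceeds `τ`. -/
theorem IsPosSol.lt_rho [Nonempty (Fin n)] (hV : FullyIndecomposable V) {τ : ℝ}
    {p : (Fin n → ℝ) × (Fin n → ℝ)} (h : IsPosSol V τ 0 p) : τ < rho V := by
  obtain ⟨-, w, hw, hVw⟩ := hV.rho_pos_and_exists_eigenvector
  have h1 := h.sum_eigenvector_mul hVw
  have h2 : ∑ i, w i * p.1 i * τ <
      ∑ i, w i * p.1 i * (τ + ((V *ᵥ p.2) i + 0) * ((Vᵀ *ᵥ p.1) i + 0)) :=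
    Finset.sum_lt_sum_of_nonempty Finset.univ_nonempty fun i _ => by
      refine mul_lt_mul_of_pos_left ?_ (mul_pos (hw i) (h.fst_pos i))
      have := mul_pos (hV.mulVec_pos h.snd_pos i) (hV.transpose.mulVec_pos h.fst_pos i)
      simpa using this
  rw [h1, ← Finset.sum_mul, zero_mul, add_zero, mul_comm] at h2
  exact lt_of_mul_lt_mul_right h2 (Finset.sum_nonneg fun i _ => (mul_pos (hw i) (h.fst_pos i)).le)

theorem tendsto_mulVec {ι : Type*} {l : Filter ι} (W : Matrix (Fin n) (Fin n) ℝ)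
    {f : ι → Fin n → ℝ} {z : Fin n → ℝ} (hf : Tendsto f l (𝓝 z)) (i : Fin n) :
    Tendsto (fun j => (W *ᵥ f j) i) l (𝓝 ((W *ᵥ z) i)) := by
  have hc : Continuous fun x : Fin n → ℝ => (W *ᵥ x) i := by
    simp only [mulVec_apply_eq_sum]
    fun_prop
  exact (hc.tendsto z).comp hf

section Limits

variable {ι : Type*} {l : Filter ι} {τ t : ι → ℝ} {p : ι → (Fin n → ℝ) × (Fin n → ℝ)} {τ₀ : ℝ}
  {z : (Fin n → ℝ) × (Fin n → ℝ)}

theorem tendsto_denom (hτ : Tendsto τ l (𝓝 τ₀)) (ht : Tendsto t l (𝓝 0))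
    (hp : Tendsto p l (𝓝 z)) (i : Fin n) :
    Tendsto (fun j => τ j + ((V *ᵥ (p j).2) i + t j) * ((Vᵀ *ᵥ (p j).1) i + t j)) l
      (𝓝 (τ₀ + (V *ᵥ z.2) i * (Vᵀ *ᵥ z.1) i)) := by
  have h1 := (tendsto_mulVec Vᵀ (hp.fst_nhds) i).add ht
  have h2 := (tendsto_mulVec V (hp.snd_nhds) i).add ht
  simpa using hτ.add (h2.mul h1)

theorem isNonnegSol_of_tendsto [l.NeBot] (hτ : Tendsto τ l (𝓝 τ₀)) (ht : Tendsto t l (𝓝 0))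
    (hp : Tendsto p l (𝓝 z)) (h : ∀ᶠ j in l, IsPosSol V (τ j) (t j) (p j)) :
    IsNonnegSol V τ₀ z := by
  have h1 : ∀ i, Tendsto (fun j => (p j).1 i) l (𝓝 (z.1 i)) := tendsto_pi_nhds.1 hp.fst_nhds
  have h2 : ∀ i, Tendsto (fun j => (p j).2 i) l (𝓝 (z.2 i)) := tendsto_pi_nhds.1 hp.snd_nhds
  refine ⟨fun i => ge_of_tendsto (h1 i) (h.mono fun j hj => (hj.fst_pos i).le),
    fun i => ge_of_tendsto (h2 i) (h.mono fun j hj => (hj.snd_pos i).le), fun i => ?_,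
    fun i => ?_, ?_⟩
  · refine tendsto_nhds_unique_of_eventuallyEq ((h1 i).mul (tendsto_denom hτ ht hp i)) ?_
      (h.mono fun j hj => hj.fst_eq i)
    simpa using (tendsto_mulVec Vᵀ hp.fst_nhds i).add ht
  · refine tendsto_nhds_unique_of_eventuallyEq ((h2 i).mul (tendsto_denom hτ ht hp i)) ?_
      (h.mono fun j hj => hj.snd_eq i)
    simpa using (tendsto_mulVec V hp.snd_nhds i).add ht
  · exact tendsto_nhds_unique_of_eventuallyEq (tendsto_finsetSum _ fun i _ => h1 i)
      (tendsto_finsetSum _ fun i _ => h2 i) (h.mono fun j hj => hj.sum_eq)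

/-- Only the zero limit has to be excluded: there all denominators would tend to `τ₀ < ρ(V)`,
against `IsPosSol.exists_rho_le`. -/
theorem isPosSol_of_tendsto [Nonempty (Fin n)] (hV : FullyIndecomposable V) [l.NeBot]
    (hτ : Tendsto τ l (𝓝 τ₀)) (ht : Tendsto t l (𝓝 0)) (ht0 : ∀ᶠ j in l, 0 ≤ t j)
    (hp : Tendsto p l (𝓝 z)) (h : ∀ᶠ j in l, IsPosSol V (τ j) (t j) (p j)) (hτ₀ : τ₀ < rho V) :
    IsPosSol V τ₀ 0 z := by
  refine (isNonnegSol_of_tendsto hτ ht hp h).isPosSol hV ?_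
  rintro rfl
  have hev : ∀ᶠ j in l, ∀ i,
      τ j + ((V *ᵥ (p j).2) i + t j) * ((Vᵀ *ᵥ (p j).1) i + t j) < rho V :=
    eventually_all.2 fun i => (tendsto_denom hτ ht hp i).eventually_lt_const (by simpa using hτ₀)
  obtain ⟨j, h1, h2, h3⟩ := (h.and (ht0.and hev)).exists
  obtain ⟨i, hi⟩ := h1.exists_rho_le hV h2
  exact absurd (h3 i) (not_lt.2 hi)

theorem HasMassBound.exists_compact (hB : HasMassBound V) (hτ : Tendsto τ l (𝓝 τ₀))
    (ht : Tendsto t l (𝓝 0)) (hτ0 : ∀ᶠ j in l, 0 ≤ τ j) (ht0 : ∀ᶠ j in l, 0 ≤ t j)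
    (h : ∀ᶠ j in l, IsPosSol V (τ j) (t j) (p j)) :
    ∃ C : Set ((Fin n → ℝ) × (Fin n → ℝ)), IsCompact C ∧ ∀ᶠ j in l, p j ∈ C := by
  obtain ⟨B, hB⟩ := hB (τ₀ + 1)
  refine ⟨Icc (0, 0) (fun _ => B, fun _ => B), isCompact_Icc, ?_⟩
  filter_upwards [h, hτ0, ht0, hτ.eventually_le_const (lt_add_one τ₀),
    ht.eventually_le_const zero_lt_one] with j hj h1 h2 h3 h4
  have h5 := hB _ _ _ h1 h3 h2 h4 hj
  refine ⟨⟨fun i => (hj.fst_pos i).le, fun i => (hj.snd_pos i).le⟩, fun i => ?_, fun i => ?_⟩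
  · exact (Finset.single_le_sum (fun i _ => (hj.fst_pos i).le) (Finset.mem_univ i)).trans h5
  · rw [hj.sum_eq] at h5
    exact (Finset.single_le_sum (fun i _ => (hj.snd_pos i).le) (Finset.mem_univ i)).trans h5

/-- The solutions stay in a compact set, and uniqueness leaves one possible cluster point. The limit
in `t` and the continuity in `τ` below the edge both come from here. -/
theorem tendsto_of_isPosSol [Nonempty (Fin n)] (hV : FullyIndecomposable V)
    (hB : HasMassBound V) (hτ₀ : 0 ≤ τ₀) (hz : IsPosSol V τ₀ 0 z) (hτ : Tendsto τ l (𝓝 τ₀))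
    (ht : Tendsto t l (𝓝 0)) (hτ0 : ∀ᶠ j in l, 0 ≤ τ j) (ht0 : ∀ᶠ j in l, 0 ≤ t j)
    (h : ∀ᶠ j in l, IsPosSol V (τ j) (t j) (p j)) : Tendsto p l (𝓝 z) := by
  obtain ⟨C, hC, hmem⟩ := hB.exists_compact hτ ht hτ0 ht0 h
  refine hC.tendsto_nhds_of_unique_mapClusterPt hmem fun y _ hy => ?_
  obtain ⟨U, hU, hy⟩ := mapClusterPt_iff_ultrafilter.1 hy
  exact hz.unique hV hτ₀ le_rfl (isPosSol_of_tendsto hV (hτ.mono_left hU) (ht.mono_left hU)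
    (ht0.filter_mono hU) hy (h.filter_mono hU) (hz.lt_rho hV))

theorem tendsto_zero_of_isPosSol [Nonempty (Fin n)] (hV : FullyIndecomposable V)
    (hB : HasMassBound V) (hτ : Tendsto τ l (𝓝 (rho V))) (hτ0 : ∀ᶠ j in l, 0 ≤ τ j)
    (h : ∀ᶠ j in l, IsPosSol V (τ j) 0 (p j)) : Tendsto p l (𝓝 0) := by
  obtain ⟨C, hC, hmem⟩ := hB.exists_compact (t := fun _ => 0) hτ tendsto_const_nhds hτ0
    (by simp) h
  refine hC.tendsto_nhds_of_unique_mapClusterPt hmem fun y _ hy => ?_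
  obtain ⟨U, hU, hy⟩ := mapClusterPt_iff_ultrafilter.1 hy
  by_contra hne
  exact lt_irrefl _ (((isNonnegSol_of_tendsto (t := fun _ => 0) (hτ.mono_left hU)
    tendsto_const_nhds hy (h.filter_mono hU)).isPosSol hV hne).lt_rho hV)

end Limits

/-- Take a cluster point of the regularized solutions as `t ↓ 0`. -/
theorem exists_isPosSol [Nonempty (Fin n)] (hV : FullyIndecomposable V)
    (hB : HasMassBound V) {τ : ℝ} (hτ : 0 ≤ τ) (hτρ : τ < rho V) : ∃ p, IsPosSol V τ 0 p := by
  choose! p hp using fun (t : ℝ) (ht : 0 < t) => exists_isPosSol_of_pos hV.1 hτ ht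
  have hev : ∀ᶠ t in 𝓝[>] (0 : ℝ), IsPosSol V τ t (p t) :=
    eventually_mem_nhdsWithin.mono fun t ht => hp t ht
  have ht : Tendsto (fun t : ℝ => t) (𝓝[>] 0) (𝓝 0) := tendsto_id.mono_left nhdsWithin_le_nhds
  have ht0 : ∀ᶠ t in 𝓝[>] (0 : ℝ), 0 ≤ t :=
    eventually_mem_nhdsWithin.mono fun t ht => (mem_Ioi.1 ht).le
  obtain ⟨C, hC, hmem⟩ := hB.exists_compact (τ := fun _ => τ) tendsto_const_nhds ht (by simp [hτ])
    ht0 hev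
  obtain ⟨z, -, hz⟩ := hC.exists_mapClusterPt_of_frequently hmem.frequently
  obtain ⟨U, hU, hz⟩ := mapClusterPt_iff_ultrafilter.1 hz
  exact ⟨z, isPosSol_of_tendsto hV (τ := fun _ => τ) tendsto_const_nhds (ht.mono_left hU)
    (ht0.filter_mono hU) hz (hev.filter_mono hU) hτρ⟩

/-! ### The solution as a function of `τ = s²` -/

open Classical in
/-- The positive solution of the master equations as a function of `τ = s²`
(`0` if there is none). -/
def posSol (V : Matrix (Fin n) (Fin n) ℝ) (τ : ℝ) : (Fin n → ℝ) × (Fin n → ℝ) :=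
  if h : ∃ p, IsPosSol V τ 0 p then h.choose else 0

theorem isPosSol_posSol [Nonempty (Fin n)] (hV : FullyIndecomposable V)
    (hB : HasMassBound V) {τ : ℝ} (hτ : 0 ≤ τ) (hτρ : τ < rho V) :
    IsPosSol V τ 0 (posSol V τ) := by
  have h := exists_isPosSol hV hB hτ hτρ
  rw [posSol, dif_pos h]
  exact h.choose_spec

theorem posSol_eq_zero [Nonempty (Fin n)] (hV : FullyIndecomposable V) {τ : ℝ}
    (hτρ : rho V ≤ τ) : posSol V τ = 0 := by
  rw [posSol, dif_neg]
  rintro ⟨p, hp⟩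
  exact absurd (hp.lt_rho hV) (not_lt.2 hτρ)

theorem continuousWithinAt_posSol [Nonempty (Fin n)] (hV : FullyIndecomposable V)
    (hB : HasMassBound V) {τ : ℝ} (hτ : 0 ≤ τ) (hτρ : τ < rho V) :
    ContinuousWithinAt (posSol V) (Ici 0) τ := by
  have hle : 𝓝[Ici 0] τ ≤ 𝓝 τ := nhdsWithin_le_nhds
  refine tendsto_of_isPosSol hV hB hτ (isPosSol_posSol hV hB hτ hτρ) (τ := fun σ => σ)
    (t := fun _ => 0) hle tendsto_const_nhds
    (eventually_mem_nhdsWithin) (by simp) ?_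
  filter_upwards [eventually_mem_nhdsWithin, hle (eventually_lt_nhds hτρ)] with σ h1 h2
  exact isPosSol_posSol hV hB h1 h2

/-- At the edge `τ = ρ(V)` the solution tends to zero, since a nonzero limit would be a positive
solution there, against `IsPosSol.lt_rho`. -/
theorem continuousOn_posSol [Nonempty (Fin n)] (hV : FullyIndecomposable V)
    (hB : HasMassBound V) : ContinuousOn (posSol V) (Ici 0) := by
  intro τ hτ
  rcases lt_trichotomy τ (rho V) with h | h | h
  · exact continuousWithinAt_posSol hV hB hτ h
  · subst h
    rw [ContinuousWithinAt, posSol_eq_zero hV le_rfl]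
    have h1 : Tendsto (posSol V) (𝓝[Ico 0 (rho V)] (rho V)) (𝓝 0) := by
      refine tendsto_zero_of_isPosSol hV hB (τ := fun σ => σ) nhdsWithin_le_nhds
        (eventually_mem_nhdsWithin.mono fun σ hσ => hσ.1) ?_
      exact eventually_mem_nhdsWithin.mono fun σ hσ => isPosSol_posSol hV hB hσ.1 hσ.2
    have h2 : Tendsto (posSol V) (𝓝[Ici (rho V)] (rho V)) (𝓝 0) :=
      tendsto_const_nhds.congr' (eventually_mem_nhdsWithin.mono fun σ hσ =>
        (posSol_eq_zero hV hσ).symm)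
    have h3 := h1.sup h2
    rw [← nhdsWithin_union, Ico_union_Ici_eq_Ici hτ] at h3
    exact h3
  · refine ContinuousAt.continuousWithinAt ?_
    refine (continuousAt_const (y := 0)).congr ?_
    filter_upwards [eventually_gt_nhds h] with σ hσ
    exact (posSol_eq_zero hV hσ.le).symm

theorem tendsto_regularizedSolution [Nonempty (Fin n)] (hV : FullyIndecomposable V)
    (hB : HasMassBound V) :
    Tendsto (fun t : ℝ => regularizedSolution V 0 t) (𝓝[>] 0) (𝓝 (posSol V 0)) := by
  refine tendsto_of_isPosSol hV hB le_rfl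
    (isPosSol_posSol hV hB le_rfl hV.rho_pos_and_exists_eigenvector.1) (τ := fun _ => 0)
    (t := fun t => t) tendsto_const_nhds nhdsWithin_le_nhds (by simp)
    (eventually_mem_nhdsWithin.mono fun t ht => (mem_Ioi.1 ht).le)
    (eventually_mem_nhdsWithin.mono fun t ht => ?_)
  simpa using isPosSol_regularizedSolution hV.1 0 ht

theorem IsMasterSolution.isNonnegSol (hV : ∀ i j, 0 ≤ V i j) {s : ℝ} (hs : 0 < s)
    {p : (Fin n → ℝ) × (Fin n → ℝ)} (h : IsMasterSolution V s p) : IsNonnegSol V (s ^ 2) p := by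
  obtain ⟨h1, h2, e1, e2, e3⟩ := h
  have pD : ∀ i, 0 < s ^ 2 + (V *ᵥ p.2) i * (Vᵀ *ᵥ p.1) i := fun i => by
    have ha := mulVec_nonneg (V := Vᵀ) (fun i j => hV j i) h1 i
    have hb := mulVec_nonneg hV h2 i
    positivity
  exact ⟨h1, h2, fun i => (eq_div_iff (pD i).ne').1 (e1 i),
    fun i => (eq_div_iff (pD i).ne').1 (e2 i), e3⟩

theorem IsNonnegSol.isMasterSolution (hV : ∀ i j, 0 ≤ V i j) {s : ℝ} (hs : 0 < s)
    {p : (Fin n → ℝ) × (Fin n → ℝ)} (h : IsNonnegSol V (s ^ 2) p) : IsMasterSolution V s p := by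
  have pD : ∀ i, 0 < s ^ 2 + (V *ᵥ p.2) i * (Vᵀ *ᵥ p.1) i := fun i => by
    have ha := mulVec_nonneg (V := Vᵀ) (fun i j => hV j i) h.fst_nonneg i
    have hb := mulVec_nonneg hV h.snd_nonneg i
    positivity
  exact ⟨h.fst_nonneg, h.snd_nonneg, fun i => (eq_div_iff (pD i).ne').2 (h.fst_eq i),
    fun i => (eq_div_iff (pD i).ne').2 (h.snd_eq i), h.sum_eq⟩

theorem masterSolution_eq_posSol [Nonempty (Fin n)] (hV : FullyIndecomposable V)
    (hB : HasMassBound V) {s : ℝ} (hs : 0 < s) : masterSolution V s = posSol V (s ^ 2) := by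
  by_cases hlt : s < Real.sqrt (rho V)
  · have hτ : s ^ 2 < rho V := (Real.lt_sqrt hs.le).1 hlt
    have h1 := isPosSol_posSol hV hB (sq_nonneg s) hτ
    have h : (0 < s ∧ s < Real.sqrt (rho V)) ∧ ∃ p, IsMasterSolution V s p ∧ p ≠ 0 := by
      refine ⟨⟨hs, hlt⟩, _, h1.isNonnegSol.isMasterSolution hV.1 hs, fun h0 => ?_⟩
      obtain ⟨i⟩ := ‹Nonempty (Fin n)›
      have := h1.fst_pos i
      simp [h0] at this
    rw [masterSolution, dif_pos h]
    exact h1.unique hV (sq_nonneg s) le_rfl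
      ((h.2.choose_spec.1.isNonnegSol hV.1 hs).isPosSol hV h.2.choose_spec.2)
  · rw [masterSolution, dif_neg fun h => hlt h.1.2, posSol_eq_zero hV]
    by_contra! h
    exact hlt ((Real.lt_sqrt hs.le).2 h)

theorem tendsto_masterSolution [Nonempty (Fin n)] (hV : FullyIndecomposable V)
    (hB : HasMassBound V) :
    Tendsto (fun s : ℝ => masterSolution V s) (𝓝[>] 0) (𝓝 (posSol V 0)) := by
  have h1 : Tendsto (fun s : ℝ => s ^ 2) (𝓝[>] 0) (𝓝[≥] 0) := by
    refine tendsto_nhdsWithin_iff.2 ⟨?_, Eventually.of_forall fun s => sq_nonneg s⟩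
    have : Continuous fun s : ℝ => s ^ 2 := by fun_prop
    simpa using (this.tendsto 0).mono_left nhdsWithin_le_nhds
  exact ((continuousOn_posSol hV hB 0 self_mem_Ici).tendsto.comp h1).congr'
    (eventually_mem_nhdsWithin.mono fun s hs => (masterSolution_eq_posSol hV hB hs).symm)

/-! ### The linearized master equations -/

theorem tendsto_clm_apply {E F ι : Type*} [NormedAddCommGroup E] [NormedSpace ℝ E]
    [NormedAddCommGroup F] [NormedSpace ℝ F] {l : Filter ι} {N : ι → E →L[ℝ] F}
    {N₀ : E →L[ℝ] F} {v : ι → E} {v₀ : E} (hN : Tendsto N l (𝓝 N₀)) (hv : Tendsto v l (𝓝 v₀)) :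
    Tendsto (fun i => N i (v i)) l (𝓝 (N₀ v₀)) :=
  ((isBoundedBilinearMap_apply (𝕜 := ℝ) (E := E) (F := F)).continuous.tendsto (N₀, v₀)).comp
    (hN.prodMk_nhds hv)

/-- `G ∘ N i` tends to the identity, hence is eventually invertible with inverse tending to the
identity. A left inverse of the limit suffices, which matters because the sum constraint adds a
coordinate to the target. -/
theorem tendsto_of_tendsto_clm_apply {E F ι : Type*} [NormedAddCommGroup E] [NormedSpace ℝ E]
    [NormedAddCommGroup F] [NormedSpace ℝ F] [CompleteSpace E] {l : Filter ι}
    {N : ι → E →L[ℝ] F} {N₀ : E →L[ℝ] F} {G : F →L[ℝ] E} {v : ι → E} {c : F}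
    (hN : Tendsto N l (𝓝 N₀)) (hG : G ∘L N₀ = 1) (hv : Tendsto (fun i => N i (v i)) l (𝓝 c)) :
    Tendsto v l (𝓝 (G c)) := by
  have hT : Tendsto (fun i => G ∘L N i) l (𝓝 (1 : E →L[ℝ] E)) := by
    rw [← hG]
    exact (((ContinuousLinearMap.compL ℝ E F E) G).continuous.tendsto N₀).comp hN
  have hinv : Tendsto (fun i => Ring.inverse (G ∘L N i)) l (𝓝 (1 : E →L[ℝ] E)) := by
    have := (NormedRing.inverse_continuousAt (1 : (E →L[ℝ] E)ˣ)).tendsto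
    rw [Units.val_one, Ring.inverse_one] at this
    exact this.comp hT
  have hunit : ∀ᶠ i in l, IsUnit (G ∘L N i) :=
    hT.eventually (Units.isOpen.mem_nhds isUnit_one)
  have h1 := tendsto_clm_apply hinv ((G.continuous.tendsto c).comp hv)
  refine h1.congr' (hunit.mono fun i hi => ?_)
  have h2 := congrArg (fun T : E →L[ℝ] E => T (v i)) (Ring.inverse_mul_cancel _ hi)
  exact h2

/-- The linear operator relating the solutions `p` at `τ` and `p'` at `τ'`: it maps `p' - p` to
`(τ' - τ) • (-p', 0)`. -/
def differenceMap (V : Matrix (Fin n) (Fin n) ℝ) (τ : ℝ) (p p' : (Fin n → ℝ) × (Fin n → ℝ)) :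
    (Fin n → ℝ) × (Fin n → ℝ) →ₗ[ℝ] ((Fin n → ℝ) × (Fin n → ℝ)) × ℝ where
  toFun v :=
    ((fun i => v.1 i * (τ + (V *ᵥ p.2) i * (Vᵀ *ᵥ p.1) i) +
        p'.1 i * ((V *ᵥ p'.2) i * (Vᵀ *ᵥ v.1) i + (Vᵀ *ᵥ p.1) i * (V *ᵥ v.2) i) - (Vᵀ *ᵥ v.1) i,
      fun i => v.2 i * (τ + (V *ᵥ p.2) i * (Vᵀ *ᵥ p.1) i) +
        p'.2 i * ((V *ᵥ p'.2) i * (Vᵀ *ᵥ v.1) i + (Vᵀ *ᵥ p.1) i * (V *ᵥ v.2) i) - (V *ᵥ v.2) i),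
      ∑ i, v.1 i - ∑ i, v.2 i)
  map_add' v w := by
    ext i
    · simp [Matrix.mulVec_add]; ring
    · simp [Matrix.mulVec_add]; ring
    · simp [Finset.sum_add_distrib]; ring
  map_smul' r v := by
    ext i
    · simp [Matrix.mulVec_smul]; ring
    · simp [Matrix.mulVec_smul]; ring
    · simp [← Finset.mul_sum]; ring

theorem continuous_differenceMap (V : Matrix (Fin n) (Fin n) ℝ) :
    Continuous fun x : ℝ × ((Fin n → ℝ) × (Fin n → ℝ)) × ((Fin n → ℝ) × (Fin n → ℝ)) =>
      LinearMap.toContinuousLinearMap (differenceMap V x.1 x.2.1 x.2.2) := by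
  rw [continuous_clm_apply]
  intro v
  simp only [LinearMap.coe_toContinuousLinearMap', differenceMap, LinearMap.coe_mk,
    AddHom.coe_mk, mulVec_apply_eq_sum]
  fun_prop

/-- The coefficients mix `p` and `p'` as in `b'a' - ba = b'(a' - a) + a(b' - b)`, so the identity
has no quadratic remainder and difference quotients solve a linear equation exactly, also at the
boundary point `τ = 0`. -/
theorem IsPosSol.differenceMap_sub {τ τ' : ℝ} {p p' : (Fin n → ℝ) × (Fin n → ℝ)}
    (h : IsPosSol V τ 0 p) (h' : IsPosSol V τ' 0 p') :
    differenceMap V τ p p' (p' - p) = (τ' - τ) • (-p', 0) := by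
  ext i
  · have e := h.fst_eq i
    have e' := h'.fst_eq i
    simp only [add_zero] at e e'
    simp [differenceMap, Matrix.mulVec_sub]
    linear_combination e' - e
  · have e := h.snd_eq i
    have e' := h'.snd_eq i
    simp only [add_zero] at e e'
    simp [differenceMap, Matrix.mulVec_sub]
    linear_combination e' - e
  · simp [differenceMap, h.sum_eq, h'.sum_eq]

theorem eq_zero_of_nonpos_add {x y : ℝ} (hx : x ≤ 0) (hy : y ≤ 0) (h : x + y = 0) : y = 0 := by
  linarith

/-- Linearized form of uniqueness. With the smallest `lam` for which `y = v.1 - lam q ≤ 0` and `z =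
v.2 + lam q̃ ≥ 0`, some coordinate vanishes, and vanishing spreads along `V`. The only candidate
`lam (q, -q̃)` is killed by the sum coordinate. -/
theorem IsPosSol.differenceMap_injective [Nonempty (Fin n)] (hV : FullyIndecomposable V) {τ : ℝ}
    (hτ : 0 ≤ τ) {p : (Fin n → ℝ) × (Fin n → ℝ)} (h : IsPosSol V τ 0 p) :
    Function.Injective (differenceMap V τ p p) := by
  rw [injective_iff_map_eq_zero]
  intro v hv
  obtain ⟨m, -, hm⟩ := Finset.exists_max_image (Finset.univ : Finset (Fin n ⊕ Fin n))
    (Sum.elim (fun i => v.1 i / p.1 i) (fun i => -v.2 i / p.2 i))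
    ⟨Sum.inl Classical.ofNonempty, Finset.mem_univ _⟩
  set lam := Sum.elim (fun i => v.1 i / p.1 i) (fun i => -v.2 i / p.2 i) m with hlamdef
  set y : Fin n → ℝ := v.1 - lam • p.1 with hy
  set z : Fin n → ℝ := v.2 + lam • p.2 with hz
  have hy0 : ∀ i, y i ≤ 0 := fun i => by
    have := (div_le_iff₀ (h.fst_pos i)).1 (hm (Sum.inl i) (Finset.mem_univ _))
    simp only [hy, Pi.sub_apply, Pi.smul_apply, smul_eq_mul]
    linarith
  have hz0 : ∀ i, 0 ≤ z i := fun i => by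
    have := (div_le_iff₀ (h.snd_pos i)).1 (hm (Sum.inr i) (Finset.mem_univ _))
    simp only [hz, Pi.add_apply, Pi.smul_apply, smul_eq_mul]
    linarith
  have hA0 : ∀ i, (Vᵀ *ᵥ y) i ≤ 0 := fun i => by
    have := mulVec_le_mulVec (V := Vᵀ) (fun i j => hV.1 j i) (y := 0) hy0 i
    simpa using this
  have hB0 : ∀ i, 0 ≤ (V *ᵥ z) i := mulVec_nonneg hV.1 hz0
  have posA : ∀ i, 0 < (Vᵀ *ᵥ p.1) i := hV.transpose.mulVec_pos h.fst_pos
  have posB : ∀ i, 0 < (V *ᵥ p.2) i := hV.mulVec_pos h.snd_pos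
  have hx1 : ∀ i, p.2 i * (Vᵀ *ᵥ p.1) i ≤ 1 := fun i => by
    simpa using h.snd_mul_le_one hV hτ le_rfl i
  have hxe : ∀ i, p.1 i * (V *ᵥ p.2) i = p.2 i * (Vᵀ *ᵥ p.1) i := fun i => by
    simpa using h.mul_eq_mul i
  have e1 : ∀ i, y i * (τ + (V *ᵥ p.2) i * (Vᵀ *ᵥ p.1) i) +
      p.1 i * ((V *ᵥ p.2) i * (Vᵀ *ᵥ y) i + (Vᵀ *ᵥ p.1) i * (V *ᵥ z) i) - (Vᵀ *ᵥ y) i = 0 :=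
    fun i => by
      have h1 := congrFun (congrArg (fun w => w.1.1) hv) i
      have h2 := h.fst_eq i
      simp only [add_zero] at h2
      simp only [differenceMap, LinearMap.coe_mk, AddHom.coe_mk, Prod.fst_zero, Pi.zero_apply]
        at h1
      simp only [hy, hz, Matrix.mulVec_sub, Matrix.mulVec_add, Matrix.mulVec_smul, Pi.sub_apply,
        Pi.add_apply, Pi.smul_apply, smul_eq_mul]
      linear_combination h1 - lam * h2
  have e2 : ∀ i, z i * (τ + (V *ᵥ p.2) i * (Vᵀ *ᵥ p.1) i) +
      p.2 i * ((V *ᵥ p.2) i * (Vᵀ *ᵥ y) i + (Vᵀ *ᵥ p.1) i * (V *ᵥ z) i) - (V *ᵥ z) i = 0 :=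
    fun i => by
      have h1 := congrFun (congrArg (fun w => w.1.2) hv) i
      have h2 := h.snd_eq i
      simp only [add_zero] at h2
      simp only [differenceMap, LinearMap.coe_mk, AddHom.coe_mk, Prod.fst_zero, Prod.snd_zero,
        Pi.zero_apply] at h1
      simp only [hy, hz, Matrix.mulVec_sub, Matrix.mulVec_add, Matrix.mulVec_smul, Pi.sub_apply,
        Pi.add_apply, Pi.smul_apply, smul_eq_mul]
      linear_combination h1 + lam * h2
  have hE : ∀ i, y i = 0 → ∀ j, V i j ≠ 0 → z j = 0 := by
    intro i hi j hij
    have h1 := e1 i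
    have h2 : (1 - p.2 i * (Vᵀ *ᵥ p.1) i) * (Vᵀ *ᵥ y) i ≤ 0 :=
      mul_nonpos_of_nonneg_of_nonpos (sub_nonneg.2 (hx1 i)) (hA0 i)
    have h3 : 0 < p.1 i * (Vᵀ *ᵥ p.1) i := mul_pos (h.fst_pos i) (posA i)
    have h4 := eq_zero_of_nonpos_add h2
      (neg_nonpos.2 (mul_nonneg h3.le (hB0 i))) (by
        rw [hi] at h1
        linear_combination -h1 + (Vᵀ *ᵥ y) i * hxe i)
    have h5 : (V *ᵥ z) i = 0 := by
      simpa [h3.ne', (h.fst_pos i).ne', (posA i).ne'] using h4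
    exact (eq_of_mulVec_eq hV.1 (x := 0) hz0 (by simp [h5]) hij).symm
  have hF : ∀ j, z j = 0 → ∀ i, V i j ≠ 0 → y i = 0 := by
    intro j hj i hij
    have h1 := e2 j
    have h2 : 0 ≤ (1 - p.2 j * (Vᵀ *ᵥ p.1) j) * (V *ᵥ z) j :=
      mul_nonneg (sub_nonneg.2 (hx1 j)) (hB0 j)
    have h3 : 0 < p.2 j * (V *ᵥ p.2) j := mul_pos (h.snd_pos j) (posB j)
    have h4 := eq_zero_of_nonpos_add (neg_nonpos.2 h2)
      (mul_nonpos_of_nonneg_of_nonpos h3.le (hA0 j)) (by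
        rw [hj] at h1
        linear_combination h1)
    have h5 : (Vᵀ *ᵥ y) j = 0 := by
      simpa [h3.ne', (h.snd_pos j).ne', (posB j).ne'] using h4
    exact eq_of_mulVec_eq (V := Vᵀ) (fun i j => hV.1 j i) (y := 0) hy0 (by simp [h5]) hij
  classical
  have key := hV.eq_univ_of_closed (E := Finset.univ.filter fun i => y i = 0)
    (F := Finset.univ.filter fun i => z i = 0)
    (fun i hi j hij => by simpa using hE i (by simpa using hi) j hij)
    (fun j hj i hij => by simpa using hF j (by simpa using hj) i hij) (by
      rcases m with m | m
      · refine Or.inl ⟨m, ?_⟩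
        simp [hy, hlamdef, div_mul_cancel₀ _ (h.fst_pos m).ne']
      · refine Or.inr ⟨m, ?_⟩
        simp [hz, hlamdef, div_mul_cancel₀ _ (h.snd_pos m).ne', neg_div])
  simp only [Finset.filter_eq_self, Finset.mem_univ, true_imp_iff] at key
  obtain ⟨k1, k2⟩ := key
  have e3 : ∑ i, v.1 i - ∑ i, v.2 i = 0 := congrArg (fun w => w.2) hv
  have k1' : ∀ i, v.1 i = lam * p.1 i := fun i => by
    have := k1 i
    simp only [hy, Pi.sub_apply, Pi.smul_apply, smul_eq_mul] at this
    linarith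
  have k2' : ∀ i, v.2 i = -(lam * p.2 i) := fun i => by
    have := k2 i
    simp only [hz, Pi.add_apply, Pi.smul_apply, smul_eq_mul] at this
    linarith
  have hS : 0 < ∑ i, p.1 i := Finset.sum_pos (fun i _ => h.fst_pos i) Finset.univ_nonempty
  have hlam : lam = 0 := by
    simp only [k1', k2', Finset.sum_neg_distrib, ← Finset.mul_sum, ← h.sum_eq] at e3
    have : lam * (2 * ∑ i, p.1 i) = 0 := by linarith
    simpa [hS.ne'] using this
  ext i
  · simp [k1', hlam]
  · simp [k2', hlam]

/-- One `d` serves all filters: applied to slopes it is the derivative at `τ₀`, applied to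
derivatives at nearby points it gives their convergence. -/
theorem IsPosSol.exists_limit_of_differenceMap [Nonempty (Fin n)] (hV : FullyIndecomposable V)
    {τ₀ : ℝ} (hτ₀ : 0 ≤ τ₀) {p₀ : (Fin n → ℝ) × (Fin n → ℝ)} (h : IsPosSol V τ₀ 0 p₀) :
    ∃ d, ∀ (l : Filter ℝ) (τ : ℝ → ℝ) (p p' v : ℝ → (Fin n → ℝ) × (Fin n → ℝ)),
      Tendsto τ l (𝓝 τ₀) → Tendsto p l (𝓝 p₀) → Tendsto p' l (𝓝 p₀) →
      Tendsto (fun i => differenceMap V (τ i) (p i) (p' i) (v i)) l (𝓝 (-p₀, 0)) →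
      Tendsto v l (𝓝 d) := by
  obtain ⟨G, hG⟩ := (differenceMap V τ₀ p₀ p₀).exists_leftInverse_of_injective
    (LinearMap.ker_eq_bot.2 (h.differenceMap_injective hV hτ₀))
  refine ⟨LinearMap.toContinuousLinearMap G (-p₀, 0), fun l τ p p' v h1 h2 h3 h4 => ?_⟩
  have h5 := ((continuous_differenceMap V).tendsto (τ₀, p₀, p₀)).comp
    (h1.prodMk_nhds (h2.prodMk_nhds h3))
  exact tendsto_of_tendsto_clm_apply h5
    (ContinuousLinearMap.ext fun v => DFunLike.congr_fun hG v) h4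

theorem tendsto_differenceMap_apply {l : Filter ℝ} {τ : ℝ → ℝ}
    {p p' v : ℝ → (Fin n → ℝ) × (Fin n → ℝ)} {τ₀ : ℝ} {p₀ p₀' v₀ : (Fin n → ℝ) × (Fin n → ℝ)}
    (h1 : Tendsto τ l (𝓝 τ₀)) (h2 : Tendsto p l (𝓝 p₀)) (h3 : Tendsto p' l (𝓝 p₀'))
    (h4 : Tendsto v l (𝓝 v₀)) :
    Tendsto (fun i => differenceMap V (τ i) (p i) (p' i) (v i)) l
      (𝓝 (differenceMap V τ₀ p₀ p₀' v₀)) :=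
  tendsto_clm_apply (((continuous_differenceMap V).tendsto (τ₀, p₀, p₀')).comp
    (h1.prodMk_nhds (h2.prodMk_nhds h3))) h4

/-- The solution is differentiable in `τ`, the derivative solves the linearized equations, and it
is determined by them in a stable way. -/
theorem exists_hasDerivWithinAt_posSol [Nonempty (Fin n)] (hV : FullyIndecomposable V)
    (hB : HasMassBound V) {τ₀ : ℝ} (hτ₀ : 0 ≤ τ₀) (hτρ : τ₀ < rho V) :
    ∃ d, HasDerivWithinAt (posSol V) d (Ici 0) τ₀ ∧
      differenceMap V τ₀ (posSol V τ₀) (posSol V τ₀) d = (-posSol V τ₀, 0) ∧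
      ∀ d' : ℝ → (Fin n → ℝ) × (Fin n → ℝ), (∀ᶠ τ in 𝓝[≥] τ₀,
        differenceMap V τ (posSol V τ) (posSol V τ) (d' τ) = (-posSol V τ, 0)) →
        Tendsto d' (𝓝[≥] τ₀) (𝓝 d) := by
  have hp₀ := isPosSol_posSol hV hB hτ₀ hτρ
  obtain ⟨d, hd⟩ := hp₀.exists_limit_of_differenceMap hV hτ₀
  have hcont := continuousOn_posSol hV hB τ₀ hτ₀
  have hcont' : Tendsto (posSol V) (𝓝[Ici 0 \ {τ₀}] τ₀) (𝓝 (posSol V τ₀)) :=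
    hcont.mono sdiff_subset
  have hneg : ∀ l : Filter ℝ, Tendsto (posSol V) l (𝓝 (posSol V τ₀)) →
      Tendsto (fun τ => ((-posSol V τ, 0) : ((Fin n → ℝ) × (Fin n → ℝ)) × ℝ)) l
        (𝓝 (-posSol V τ₀, 0)) := fun l hl => hl.neg.prodMk_nhds tendsto_const_nhds
  have hslope : ∀ᶠ τ in 𝓝[Ici 0 \ {τ₀}] τ₀,
      differenceMap V τ₀ (posSol V τ₀) (posSol V τ) (slope (posSol V) τ₀ τ) =
        (-posSol V τ, 0) := by
    filter_upwards [eventually_mem_nhdsWithin,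
      nhdsWithin_le_nhds (eventually_lt_nhds hτρ)] with τ h1 h2
    have hne : τ - τ₀ ≠ 0 := sub_ne_zero.2 h1.2
    rw [slope_def_module, map_smul, hp₀.differenceMap_sub (isPosSol_posSol hV hB h1.1 h2),
      smul_smul, inv_mul_cancel₀ hne, one_smul]
  have hderiv : Tendsto (slope (posSol V) τ₀) (𝓝[Ici 0 \ {τ₀}] τ₀) (𝓝 d) :=
    hd _ (fun _ => τ₀) (fun _ => posSol V τ₀) (posSol V) _ tendsto_const_nhds
      tendsto_const_nhds hcont' ((hneg _ hcont').congr' (hslope.mono fun τ h => h.symm))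
  have hbot : (𝓝[Ici 0 \ {τ₀}] τ₀).NeBot := by
    refine NeBot.mono (inferInstance : (𝓝[>] τ₀).NeBot) (nhdsWithin_mono _ fun τ hτ => ?_)
    exact ⟨hτ₀.trans (le_of_lt hτ), ne_of_gt hτ⟩
  refine ⟨d, hasDerivWithinAt_iff_tendsto_slope.2 hderiv, ?_, fun d' hd' => ?_⟩
  · exact tendsto_nhds_unique_of_eventuallyEq (tendsto_differenceMap_apply
      (tendsto_const_nhds (x := τ₀)) (tendsto_const_nhds (x := posSol V τ₀)) hcont' hderiv)
      (hneg _ hcont') hslope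
  · have h1 : Tendsto (posSol V) (𝓝[≥] τ₀) (𝓝 (posSol V τ₀)) :=
      hcont.mono (Ici_subset_Ici.2 hτ₀)
    exact hd _ (fun τ => τ) (posSol V) (posSol V) _ nhdsWithin_le_nhds h1 h1
      ((hneg _ h1).congr' (hd'.mono fun τ h => h.symm))

/-! ### Monotonicity of the radial distribution function -/

/-- Put `x_i = q_i (Vq̃)_i`, with derivative `x'`, and let `u`, `w` be the logarithmic derivatives
of `q`, `q̃`. The matrix `P_ij = q_i V_ij q̃_j` has row and column sums `x`, and `P_ij (u_i + w_j)`
has row and column sums `x'`. Hence `∑ (u + w) x' = ∑ P_ij (u_i + w_j)²`, which is at least `∑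
x'²/x` by Cauchy-Schwarz. Differentiating `x(1 - x) = τ q q̃` bounds `x'/τ` by `x'²/x - (u + w) x'`,
and summation gives the sign. -/
theorem IsPosSol.sum_deriv_nonpos (hV : FullyIndecomposable V) {τ : ℝ} (hτ : 0 < τ)
    {p d : (Fin n → ℝ) × (Fin n → ℝ)} (h : IsPosSol V τ 0 p)
    (hd : differenceMap V τ p p d = (-p, 0)) :
    ∑ i, (d.1 i * (V *ᵥ p.2) i + p.1 i * (V *ᵥ d.2) i) ≤ 0 := by
  set a : Fin n → ℝ := fun i => (Vᵀ *ᵥ p.1) i with ha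
  set b : Fin n → ℝ := fun i => (V *ᵥ p.2) i with hb
  set A : Fin n → ℝ := fun i => (Vᵀ *ᵥ d.1) i with hA
  set B : Fin n → ℝ := fun i => (V *ᵥ d.2) i with hB
  set x : Fin n → ℝ := fun i => p.1 i * b i with hx
  set x' : Fin n → ℝ := fun i => d.1 i * b i + p.1 i * B i with hx'
  set u : Fin n → ℝ := fun i => d.1 i / p.1 i with hu
  set w : Fin n → ℝ := fun i => d.2 i / p.2 i with hw
  have posA : ∀ i, 0 < a i := hV.transpose.mulVec_pos h.fst_pos
  have posB : ∀ i, 0 < b i := hV.mulVec_pos h.snd_pos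
  have pq := h.fst_pos
  have pr := h.snd_pos
  have hu' : ∀ i, d.1 i = u i * p.1 i := fun i => by
    simp only [hu]; rw [div_mul_cancel₀ _ (pq i).ne']
  have hw' : ∀ i, d.2 i = w i * p.2 i := fun i => by
    simp only [hw]; rw [div_mul_cancel₀ _ (pr i).ne']
  have s1 : ∀ i, p.1 i * (τ + b i * a i) = a i := fun i => by simpa using h.fst_eq i
  have s2 : ∀ i, p.2 i * (τ + b i * a i) = b i := fun i => by simpa using h.snd_eq i
  have e1 : ∀ i, d.1 i * (τ + b i * a i) + p.1 i * (b i * A i + a i * B i) - A i = -p.1 i :=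
    fun i => congrFun (congrArg (fun w => w.1.1) hd) i
  have e2 : ∀ i, d.2 i * (τ + b i * a i) + p.2 i * (b i * A i + a i * B i) - B i = -p.2 i :=
    fun i => congrFun (congrArg (fun w => w.1.2) hd) i
  have hxx : ∀ i, x i = p.2 i * a i := fun i => by
    simp only [hx]; linear_combination p.2 i * s1 i - p.1 i * s2 i
  have hxx' : ∀ i, x' i = d.2 i * a i + p.2 i * A i := fun i => by
    simp only [hx']
    linear_combination p.2 i * e1 i - p.1 i * e2 i - d.1 i * s2 i + d.2 i * s1 i
  have hxpos : ∀ i, 0 < x i := fun i => mul_pos (pq i) (posB i)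
  have hxτ : ∀ i, x i * (1 - x i) = τ * (p.1 i * p.2 i) := fun i => by
    have h1 := hxx i
    simp only [hx] at h1 ⊢
    linear_combination -p.1 i * s2 i - p.1 i * b i * h1
  have hx1 : ∀ i, x i < 1 := fun i => by
    have h1 : 0 < x i * (1 - x i) := by
      rw [hxτ]; exact mul_pos hτ (mul_pos (pq i) (pr i))
    have := (pos_iff_pos_of_mul_pos h1).1 (hxpos i)
    linarith
  -- The derivative in `τ` of `x(1 - x) = τ q q̃`, in logarithmic form.
  have hrel : ∀ i, (u i + w i) * (x i * (1 - x i)) = x' i * (1 - 2 * x i) - p.1 i * p.2 i := by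
    intro i
    rw [hxτ]
    have h1 : (u i + w i) * (τ * (p.1 i * p.2 i)) = τ * (d.1 i * p.2 i + p.1 i * d.2 i) := by
      rw [hu', hw']; ring
    rw [h1]
    have k1 := hxx i
    have k2 := hxx' i
    have k3 : τ * (d.1 i * p.2 i) = (1 - x i) * (d.1 i * b i) := by
      rw [k1]
      linear_combination d.1 i * s2 i
    have k4 : τ * (p.1 i * d.2 i) = (1 - x i) * (d.2 i * a i) := by
      simp only [hx]
      linear_combination d.2 i * s1 i
    have k5 : d.1 i * b i + x i * (p.2 i * A i) + x i * (p.1 i * B i) - p.2 i * A i =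
        -(p.1 i * p.2 i) := by
      have : d.1 i * b i + p.2 i * (p.1 i * b i) * A i + p.1 i * (p.2 i * a i) * B i
          - p.2 i * A i = -(p.1 i * p.2 i) := by
        linear_combination p.2 i * e1 i - d.1 i * s2 i
      rw [← k1] at this
      simp only [hx] at this ⊢
      linear_combination this
    have k6 : x' i = d.1 i * b i + p.1 i * B i := rfl
    linear_combination k3 + k4 + k5 + (x i - 1) * k2 + x i * k6
  have hP1 : ∀ i, ∑ j, p.1 i * V i j * p.2 j = x i := fun i => by
    simp only [hx, hb, mulVec_apply_eq_sum, Finset.mul_sum, mul_assoc]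
  have hP2 : ∀ j, ∑ i, p.1 i * V i j * p.2 j = x j := fun j => by
    rw [hxx]
    simp only [ha, mulVec_apply_eq_sum, Finset.mul_sum, Matrix.transpose_apply]
    exact Finset.sum_congr rfl fun i _ => by ring
  have hP3 : ∀ i, ∑ j, p.1 i * V i j * p.2 j * (u i + w j) = x' i := fun i => by
    simp only [mul_add, Finset.sum_add_distrib]
    rw [← Finset.sum_mul, hP1]
    simp only [hx', hx, hu', hB, mulVec_apply_eq_sum, Finset.mul_sum, hw']
    congr 1
    · ring
    · exact Finset.sum_congr rfl fun i _ => by ring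
  have hP4 : ∀ j, ∑ i, p.1 i * V i j * p.2 j * (u i + w j) = x' j := fun j => by
    simp only [mul_add, Finset.sum_add_distrib]
    rw [← Finset.sum_mul, hP2, hxx']
    simp only [hxx, hw', hA, mulVec_apply_eq_sum, Finset.mul_sum, hu', Matrix.transpose_apply]
    rw [add_comm]
    congr 1
    · ring
    · exact Finset.sum_congr rfl fun i _ => by ring
  have hE : ∑ i, ∑ j, p.1 i * V i j * p.2 j * (u i + w j) ^ 2 = ∑ i, (u i + w i) * x' i := by
    have h1 : ∑ i, ∑ j, p.1 i * V i j * p.2 j * (u i + w j) ^ 2 =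
        ∑ i, u i * ∑ j, p.1 i * V i j * p.2 j * (u i + w j) +
        ∑ j, w j * ∑ i, p.1 i * V i j * p.2 j * (u i + w j) := by
      simp only [Finset.mul_sum]
      rw [Finset.sum_comm (f := fun j i => w j * (p.1 i * V i j * p.2 j * (u i + w j))),
        ← Finset.sum_add_distrib]
      refine Finset.sum_congr rfl fun i _ => ?_
      rw [← Finset.sum_add_distrib]
      exact Finset.sum_congr rfl fun j _ => by ring
    rw [h1]
    simp only [hP3, hP4, add_mul, Finset.sum_add_distrib]
  have hCS : ∀ i, x' i ^ 2 / x i ≤ ∑ j, p.1 i * V i j * p.2 j * (u i + w j) ^ 2 := fun i => by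
    rw [div_le_iff₀ (hxpos i), mul_comm, ← hP3 i]
    conv_rhs => rw [← hP1 i]
    have hPnn : ∀ j, 0 ≤ p.1 i * V i j * p.2 j := fun j =>
      mul_nonneg (mul_nonneg (pq i).le (hV.1 i j)) (pr j).le
    exact Finset.sum_sq_le_sum_mul_sum_of_sq_le_mul _ (fun j _ => hPnn j)
      (fun j _ => mul_nonneg (hPnn j) (sq_nonneg _)) fun j _ => le_of_eq (by ring)
  -- Uses `(1 - 2x)/(1 - x) ≤ 1` for `0 < x < 1`.
  have hloc : ∀ i, x' i / τ ≤ x' i ^ 2 / x i - (u i + w i) * x' i := fun i => by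
    have h1 := hrel i
    have h2 := hxτ i
    have hX := hxpos i
    have h1X : 0 < 1 - x i := sub_pos.2 (hx1 i)
    have h3 : x' i / τ = x' i ^ 2 * (1 - 2 * x i) / (x i * (1 - x i)) - (u i + w i) * x' i := by
      rw [eq_sub_iff_add_eq, div_add' _ _ _ hτ.ne', div_eq_div_iff hτ.ne' (mul_pos hX h1X).ne']
      linear_combination x' i * h2 + τ * x' i * h1
    rw [h3]
    refine sub_le_sub_right ?_ _
    rw [div_le_div_iff₀ (mul_pos hX h1X) hX]
    have h4 : 0 ≤ x' i ^ 2 * (x i * x i) := by positivity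
    linarith
  have hsum : (∑ i, x' i) / τ ≤ 0 := by
    rw [Finset.sum_div]
    calc ∑ i, x' i / τ ≤ ∑ i, (x' i ^ 2 / x i - (u i + w i) * x' i) :=
          Finset.sum_le_sum fun i _ => hloc i
      _ = ∑ i, x' i ^ 2 / x i - ∑ i, (u i + w i) * x' i := Finset.sum_sub_distrib ..
      _ ≤ 0 := by
        rw [← hE, sub_nonpos]
        exact Finset.sum_le_sum fun i _ => hCS i
  have h0 := (div_le_iff₀ hτ).1 hsum
  rwa [zero_mul] at h0

/-! ### The radial distribution function -/

/-- The radial distribution function as a function of `τ = s²`. -/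
def cdfSq (V : Matrix (Fin n) (Fin n) ℝ) (τ : ℝ) : ℝ :=
  1 - (1 / (n : ℝ)) * ((posSol V τ).1 ⬝ᵥ (V *ᵥ (posSol V τ).2))

theorem radialCDF_eq_cdfSq [Nonempty (Fin n)] (hV : FullyIndecomposable V)
    (hB : HasMassBound V) {s : ℝ} (hs : 0 < s) : radialCDF V s = cdfSq V (s ^ 2) := by
  rw [radialCDF, masterSolution_eq_posSol hV hB hs, cdfSq]

theorem cdfSq_of_rho_le [Nonempty (Fin n)] (hV : FullyIndecomposable V) {τ : ℝ}
    (hτ : rho V ≤ τ) : cdfSq V τ = 1 := by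
  simp [cdfSq, posSol_eq_zero hV hτ]

theorem continuousOn_cdfSq [Nonempty (Fin n)] (hV : FullyIndecomposable V)
    (hB : HasMassBound V) : ContinuousOn (cdfSq V) (Ici 0) := by
  have hc : Continuous fun p : (Fin n → ℝ) × (Fin n → ℝ) =>
      1 - (1 / (n : ℝ)) * (p.1 ⬝ᵥ (V *ᵥ p.2)) := by
    simp only [dotProduct, mulVec_apply_eq_sum]
    fun_prop
  exact hc.comp_continuousOn (continuousOn_posSol hV hB)

/-- Each term satisfies `1 - q_i b_i = τ q_i / a_i`. The explicit factor `τ` gives both the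
vanishing at the origin and the slope there. -/
theorem IsPosSol.one_sub_average (hn : (n : ℝ) ≠ 0) (hV : FullyIndecomposable V) {τ : ℝ}
    {p : (Fin n → ℝ) × (Fin n → ℝ)} (h : IsPosSol V τ 0 p) :
    1 - (1 / (n : ℝ)) * (p.1 ⬝ᵥ (V *ᵥ p.2)) =
      τ * ((1 / (n : ℝ)) * ∑ i, p.1 i / (Vᵀ *ᵥ p.1) i) := by
  have h1 : ∀ i, p.1 i * (V *ᵥ p.2) i = 1 - τ * (p.1 i / (Vᵀ *ᵥ p.1) i) := fun i => by
    have h2 := h.fst_eq i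
    have h3 := (hV.transpose.mulVec_pos h.fst_pos i).ne'
    simp only [add_zero] at h2
    field_simp
    linear_combination h2
  simp only [dotProduct, h1, Finset.sum_sub_distrib, ← Finset.mul_sum]
  simp only [Finset.sum_const, Finset.card_univ, Fintype.card_fin, nsmul_eq_mul]
  field_simp
  ring

theorem cdfSq_eq_mul [Nonempty (Fin n)] (hV : FullyIndecomposable V)
    (hB : HasMassBound V) {τ : ℝ} (hτ : 0 ≤ τ) (hτρ : τ < rho V) :
    cdfSq V τ =
      τ * ((1 / (n : ℝ)) * ∑ i, (posSol V τ).1 i / (Vᵀ *ᵥ (posSol V τ).1) i) := by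
  have hn : (n : ℝ) ≠ 0 := by
    obtain ⟨i⟩ := ‹Nonempty (Fin n)›
    exact_mod_cast i.pos.ne'
  exact (isPosSol_posSol hV hB hτ hτρ).one_sub_average hn hV

theorem cdfSq_zero [Nonempty (Fin n)] (hV : FullyIndecomposable V)
    (hB : HasMassBound V) : cdfSq V 0 = 0 := by
  rw [cdfSq_eq_mul hV hB le_rfl hV.rho_pos_and_exists_eigenvector.1, zero_mul]

/-- The derivative of `cdfSq` when the solution is `p` and its derivative is `d`. -/
def cdfSqDeriv (V : Matrix (Fin n) (Fin n) ℝ) (p d : (Fin n → ℝ) × (Fin n → ℝ)) : ℝ :=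
  -(1 / (n : ℝ) * ∑ i, (d.1 i * (V *ᵥ p.2) i + p.1 i * (V *ᵥ d.2) i))

theorem tendsto_cdfSqDeriv {ι : Type*} {l : Filter ι} {p d : ι → (Fin n → ℝ) × (Fin n → ℝ)}
    {p₀ d₀ : (Fin n → ℝ) × (Fin n → ℝ)} (hp : Tendsto p l (𝓝 p₀)) (hd : Tendsto d l (𝓝 d₀)) :
    Tendsto (fun j => cdfSqDeriv V (p j) (d j)) l (𝓝 (cdfSqDeriv V p₀ d₀)) :=
  ((tendsto_finsetSum _ fun i _ =>
    ((tendsto_pi_nhds.1 hd.fst_nhds i).mul (tendsto_mulVec V hp.snd_nhds i)).add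
      ((tendsto_pi_nhds.1 hp.fst_nhds i).mul (tendsto_mulVec V hd.snd_nhds i))).const_mul _).neg

theorem IsPosSol.cdfSqDeriv_nonneg (hV : FullyIndecomposable V) {τ : ℝ} (hτ : 0 < τ)
    {p d : (Fin n → ℝ) × (Fin n → ℝ)} (h : IsPosSol V τ 0 p)
    (hd : differenceMap V τ p p d = (-p, 0)) : 0 ≤ cdfSqDeriv V p d :=
  neg_nonneg.2 (mul_nonpos_of_nonneg_of_nonpos
    (div_nonneg zero_le_one (Nat.cast_nonneg (α := ℝ) n)) (h.sum_deriv_nonpos hV hτ hd))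

theorem hasDerivWithinAt_cdfSq {τ : ℝ} {d : (Fin n → ℝ) × (Fin n → ℝ)} {s : Set ℝ}
    (h : HasDerivWithinAt (posSol V) d s τ) :
    HasDerivWithinAt (cdfSq V) (cdfSqDeriv V (posSol V τ) d) s τ := by
  have h1 : ∀ i, HasDerivWithinAt (fun σ => (posSol V σ).1 i) (d.1 i) s τ := fun i => by
    simpa using hasDerivWithinAt_pi.1 h.hasFDerivWithinAt.fst.hasDerivWithinAt i
  have h2 : ∀ i, HasDerivWithinAt (fun σ => (posSol V σ).2 i) (d.2 i) s τ := fun i => by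
    simpa using hasDerivWithinAt_pi.1 h.hasFDerivWithinAt.snd.hasDerivWithinAt i
  have h3 : ∀ i, HasDerivWithinAt (fun σ => (V *ᵥ (posSol V σ).2) i) ((V *ᵥ d.2) i) s τ :=
    fun i => by
      simp only [mulVec_apply_eq_sum]
      exact HasDerivWithinAt.fun_sum fun j _ => (h2 j).const_mul _
  change HasDerivWithinAt (fun σ => 1 - 1 / (n : ℝ) *
    ∑ i, (posSol V σ).1 i * (V *ᵥ (posSol V σ).2) i) _ s τ
  exact ((HasDerivWithinAt.fun_sum fun i _ => (h1 i).mul (h3 i)).const_mul _).const_sub _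

/-- The limit of `cdfSq V τ / τ` at `0`. -/
def slopeZero (V : Matrix (Fin n) (Fin n) ℝ) : ℝ :=
  1 / (n : ℝ) * ∑ i, (posSol V 0).1 i / (Vᵀ *ᵥ (posSol V 0).1) i

theorem tendsto_slope_cdfSq [Nonempty (Fin n)] (hV : FullyIndecomposable V)
    (hB : HasMassBound V) : Tendsto (slope (cdfSq V) 0) (𝓝[>] 0) (𝓝 (slopeZero V)) := by
  have hρ := hV.rho_pos_and_exists_eigenvector.1
  have hposA := hV.transpose.mulVec_pos (isPosSol_posSol hV hB le_rfl hρ).fst_pos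
  have hp : Tendsto (fun τ => (posSol V τ).1) (𝓝[>] 0) (𝓝 (posSol V 0).1) :=
    ((continuousOn_posSol hV hB 0 self_mem_Ici).mono Ioi_subset_Ici_self).fst_nhds
  have h2 : Tendsto (fun τ => 1 / (n : ℝ) *
      ∑ i, (posSol V τ).1 i / (Vᵀ *ᵥ (posSol V τ).1) i) (𝓝[>] 0) (𝓝 (slopeZero V)) :=
    (tendsto_finsetSum _ fun i _ => (tendsto_pi_nhds.1 hp i).div (tendsto_mulVec Vᵀ hp i)
      (hposA i).ne').const_mul _
  refine h2.congr' ?_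
  filter_upwards [eventually_mem_nhdsWithin,
    nhdsWithin_le_nhds (eventually_lt_nhds hρ)] with τ h3 h4
  have h3' : (0 : ℝ) < τ := h3
  rw [slope_def_field, cdfSq_zero hV hB, cdfSq_eq_mul hV hB h3'.le h4, sub_zero, sub_zero,
    mul_div_cancel_left₀ _ h3'.ne']

/-- The distribution function is differentiable on `[0, ρ(V))` as a function of `τ = s²`, with a
nonnegative derivative that is continuous at `0`. -/
theorem exists_deriv_cdfSq [Nonempty (Fin n)] (hV : FullyIndecomposable V)
    (hB : HasMassBound V) :
    ∃ D : ℝ → ℝ, (∀ τ, 0 ≤ τ → τ < rho V → HasDerivWithinAt (cdfSq V) (D τ) (Ici 0) τ) ∧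
      (∀ τ, 0 < τ → τ < rho V → 0 ≤ D τ) ∧ Tendsto D (𝓝[≥] 0) (𝓝 (slopeZero V)) := by
  have hρ := hV.rho_pos_and_exists_eigenvector.1
  choose! d hd1 hd2 hd3 using fun (τ : ℝ) (h0 : 0 ≤ τ) (h1 : τ < rho V) =>
    exists_hasDerivWithinAt_posSol hV hB h0 h1
  have hderiv : ∀ τ, 0 ≤ τ → τ < rho V →
      HasDerivWithinAt (cdfSq V) (cdfSqDeriv V (posSol V τ) (d τ)) (Ici 0) τ :=
    fun τ h0 h1 => hasDerivWithinAt_cdfSq (hd1 τ h0 h1)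
  refine ⟨_, hderiv, fun τ h0 h1 =>
    (isPosSol_posSol hV hB h0.le h1).cdfSqDeriv_nonneg hV h0 (hd2 τ h0.le h1), ?_⟩
  have hev : ∀ᶠ τ in 𝓝[≥] (0 : ℝ), 0 ≤ τ ∧ τ < rho V :=
    (eventually_mem_nhdsWithin).and (nhdsWithin_le_nhds (eventually_lt_nhds hρ))
  have hdt : Tendsto d (𝓝[≥] 0) (𝓝 (d 0)) :=
    hd3 0 le_rfl hρ d (hev.mono fun τ h => hd2 τ h.1 h.2)
  have h1 := hasDerivWithinAt_iff_tendsto_slope.1 (hderiv 0 le_rfl hρ)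
  rw [Ici_sdiff_left] at h1
  -- The derivative at `0` is a one-sided limit of slopes, hence the explicit `slopeZero`.
  rw [← tendsto_nhds_unique h1 (tendsto_slope_cdfSq hV hB)]
  exact tendsto_cdfSqDeriv (continuousOn_posSol hV hB 0 self_mem_Ici) hdt

/-! ### Radial measures on the plane -/

theorem lintegral_comp_norm {g : ℝ → ENNReal} (hg : Measurable g) :
    ∫⁻ z : ℂ, g ‖z‖ = ∫⁻ r in Ioi (0 : ℝ), ENNReal.ofReal (2 * Real.pi * r) * g r := by
  rw [← Complex.lintegral_comp_polarCoord_symm]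
  have hm : Measurable fun p : ℝ × ℝ => ENNReal.ofReal p.1 * g |p.1| :=
    (ENNReal.measurable_ofReal.comp measurable_fst).mul
      (hg.comp (continuous_abs.measurable.comp measurable_fst))
  simp only [Complex.norm_polarCoord_symm, smul_eq_mul]
  rw [polarCoord_target, Measure.volume_eq_prod, setLIntegral_prod _ hm.aemeasurable]
  refine setLIntegral_congr_fun measurableSet_Ioi fun r hr => ?_
  have hr' : (0 : ℝ) < r := hr
  simp only [lintegral_const, Measure.restrict_apply MeasurableSet.univ, univ_inter,
    Real.volume_Ioo, abs_of_pos hr']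
  rw [mul_right_comm, ← ENNReal.ofReal_mul hr'.le]
  congr 2
  ring

theorem lintegral_comp_mul_circle_eq [MeasurableSpace Circle] [BorelSpace Circle]
    (ν : Measure Circle) [ν.IsMulRightInvariant] (g : ℂ → ENNReal) (z : ℂ) :
    ∫⁻ w : Circle, g (w * z) ∂ν = ∫⁻ w : Circle, g (w * (‖z‖ : ℂ)) ∂ν := by
  obtain ⟨c, hc⟩ : ∃ c : Circle, (c : ℂ) * ‖z‖ = z :=
    ⟨Circle.exp z.arg, by rw [Circle.coe_exp, mul_comm]; exact Complex.norm_mul_exp_arg_mul_I z⟩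
  rw [← lintegral_mul_right_eq_self (fun w : Circle => g (w * (‖z‖ : ℂ))) c]
  refine lintegral_congr fun w => ?_
  rw [Circle.coe_mul, mul_assoc, hc]

/-- The mass of a set under a rotation invariant measure is determined by the distribution of
the norm. -/
theorem measure_mul_eq_lintegral_map_norm [MeasurableSpace Circle] [BorelSpace Circle]
    (ν : Measure Circle) [IsFiniteMeasure ν] [ν.IsMulRightInvariant] {μ : Measure ℂ} [SFinite μ]
    (h : ∀ w : ℂ, ‖w‖ = 1 → μ.map (fun z => w * z) = μ) {s : Set ℂ} (hs : MeasurableSet s) :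
    μ s * ν univ =
      ∫⁻ r, ∫⁻ w : Circle, s.indicator 1 ((w : ℂ) * (r : ℂ)) ∂ν ∂(μ.map fun z => ‖z‖) := by
  have hind : Measurable (s.indicator (1 : ℂ → ENNReal)) := measurable_one.indicator hs
  have hcirc : Measurable fun w : Circle => (w : ℂ) :=
    (by fun_prop : Continuous fun w : Circle => (w : ℂ)).measurable
  have h1 : ∀ w : Circle, ∫⁻ z, s.indicator 1 ((w : ℂ) * z) ∂μ = μ s := fun w => by
    rw [← lintegral_map hind (measurable_const_mul (w : ℂ)), h w (Circle.norm_coe w),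
      lintegral_indicator_one hs]
  have h2 : Measurable fun x : Circle × ℂ => s.indicator (1 : ℂ → ENNReal) ((x.1 : ℂ) * x.2) :=
    hind.comp ((hcirc.comp measurable_fst).mul measurable_snd)
  have h3 : Measurable fun x : ℝ × Circle =>
      s.indicator (1 : ℂ → ENNReal) ((x.2 : ℂ) * (x.1 : ℂ)) :=
    hind.comp ((hcirc.comp measurable_snd).mul (Complex.measurable_ofReal.comp measurable_fst))
  calc μ s * ν univ = ∫⁻ w : Circle, ∫⁻ z, s.indicator 1 ((w : ℂ) * z) ∂μ ∂ν := by
        simp only [h1, lintegral_const]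
    _ = ∫⁻ z, ∫⁻ w : Circle, s.indicator 1 ((w : ℂ) * z) ∂ν ∂μ :=
        lintegral_lintegral_swap h2.aemeasurable
    _ = ∫⁻ z, ∫⁻ w : Circle, s.indicator 1 ((w : ℂ) * (‖z‖ : ℂ)) ∂ν ∂μ :=
        lintegral_congr fun z => lintegral_comp_mul_circle_eq ν _ z
    _ = _ := (lintegral_map h3.lintegral_prod_right' measurable_norm).symm

/-- Averaging over rotations with Haar measure on the circle expresses the mass of a set through the
law of the norm alone. -/
theorem eq_of_map_norm_eq {μ μ' : Measure ℂ} [SFinite μ] [SFinite μ']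
    (h : ∀ w : ℂ, ‖w‖ = 1 → μ.map (fun z => w * z) = μ)
    (h' : ∀ w : ℂ, ‖w‖ = 1 → μ'.map (fun z => w * z) = μ')
    (hnorm : μ.map (fun z => ‖z‖) = μ'.map fun z => ‖z‖) : μ = μ' := by
  let _ : MeasurableSpace Circle := borel Circle
  have _ : BorelSpace Circle := ⟨rfl⟩
  let ν : Measure Circle := Measure.haar
  ext s hs
  have h1 := measure_mul_eq_lintegral_map_norm ν h hs
  rw [hnorm, ← measure_mul_eq_lintegral_map_norm ν h' hs] at h1
  exact (ENNReal.mul_left_inj (Measure.measure_univ_ne_zero.2 (NeZero.ne ν))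
    (measure_ne_top ν _)).1 h1

theorem IsDeterministicEquivalent.measure_zero {μ : Measure ℂ}
    (h : IsDeterministicEquivalent V μ) (h0 : Tendsto (radialCDF V) (𝓝[>] 0) (𝓝 0)) :
    μ {0} = 0 := by
  have := h.prob
  have h1 : μ.real {0} ≤ 0 := by
    refine ge_of_tendsto h0 (eventually_mem_nhdsWithin.mono fun s hs => ?_)
    rw [← h.cdf s hs]
    exact measureReal_mono fun z hz => by
      rw [mem_singleton_iff.1 hz]
      simpa using (mem_Ioi.1 hs).le
  exact (measureReal_eq_zero_iff).1 (le_antisymm h1 measureReal_nonneg)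

/-- The distribution function is prescribed only for `s > 0`; its limit at `0` excludes an atom at
the origin. -/
theorem IsDeterministicEquivalent.unique {μ μ' : Measure ℂ}
    (h : IsDeterministicEquivalent V μ) (h' : IsDeterministicEquivalent V μ')
    (h0 : Tendsto (radialCDF V) (𝓝[>] 0) (𝓝 0)) : μ = μ' := by
  have := h.prob
  have := h'.prob
  refine eq_of_map_norm_eq h.radial h'.radial ?_
  have := Measure.isProbabilityMeasure_map (μ := μ) measurable_norm.aemeasurable
  refine Measure.ext_of_Iic _ _ fun a => ?_
  rw [Measure.map_apply measurable_norm measurableSet_Iic,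
    Measure.map_apply measurable_norm measurableSet_Iic]
  rcases lt_trichotomy a 0 with ha | ha | ha
  · have : (fun z : ℂ => ‖z‖) ⁻¹' Iic a = ∅ := by
      ext z
      simpa using ha.trans_le (norm_nonneg z)
    simp [this]
  · have : (fun z : ℂ => ‖z‖) ⁻¹' Iic a = {0} := by
      ext z
      simp [ha]
    rw [this, h.measure_zero h0, h'.measure_zero h0]
  · refine (measureReal_eq_measureReal_iff).1 ?_
    exact (h.cdf a ha).trans (h'.cdf a ha).symm

/-! ### The density of the deterministic equivalent -/

theorem tendsto_sq_nhdsGE : Tendsto (fun s : ℝ => s ^ 2) (𝓝[>] 0) (𝓝[≥] 0) := by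
  refine tendsto_nhdsWithin_iff.2 ⟨?_, Eventually.of_forall fun s => sq_nonneg s⟩
  have : Continuous fun s : ℝ => s ^ 2 := by fun_prop
  simpa using (this.tendsto 0).mono_left nhdsWithin_le_nhds

theorem tendsto_radialCDF_zero [Nonempty (Fin n)] (hV : FullyIndecomposable V)
    (hB : HasMassBound V) : Tendsto (radialCDF V) (𝓝[>] 0) (𝓝 0) := by
  have h1 := (continuousOn_cdfSq hV hB 0 self_mem_Ici).tendsto.comp tendsto_sq_nhdsGE
  rw [cdfSq_zero hV hB] at h1
  exact h1.congr' (eventually_mem_nhdsWithin.mono fun s hs => (radialCDF_eq_cdfSq hV hB hs).symm)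

theorem hasDerivAt_cdfSq_sq {D : ℝ → ℝ}
    (hD : ∀ τ, 0 ≤ τ → τ < rho V → HasDerivWithinAt (cdfSq V) (D τ) (Ici 0) τ) {s : ℝ}
    (hs : 0 < s) (hsρ : s < Real.sqrt (rho V)) :
    HasDerivAt (fun s => cdfSq V (s ^ 2)) (D (s ^ 2) * (2 * s)) s := by
  have h1 := (hD (s ^ 2) (sq_nonneg s) ((Real.lt_sqrt hs.le).1 hsρ)).hasDerivAt
    (Ici_mem_nhds (by positivity))
  have h2 : HasDerivAt (fun s : ℝ => s ^ 2) (2 * s) s := by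
    simpa using hasDerivAt_pow 2 s
  exact HasDerivAt.comp (h₂ := cdfSq V) (h := fun s : ℝ => s ^ 2) s h1 h2

theorem deriv_radialCDF [Nonempty (Fin n)] (hV : FullyIndecomposable V)
    (hB : HasMassBound V) {D : ℝ → ℝ}
    (hD : ∀ τ, 0 ≤ τ → τ < rho V → HasDerivWithinAt (cdfSq V) (D τ) (Ici 0) τ) {s : ℝ}
    (hs : 0 < s) (hsρ : s < Real.sqrt (rho V)) :
    deriv (radialCDF V) s = D (s ^ 2) * (2 * s) := by
  refine ((hasDerivAt_cdfSq_sq hD hs hsρ).congr_of_eventuallyEq ?_).deriv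
  filter_upwards [eventually_gt_nhds hs] with r hr
  exact radialCDF_eq_cdfSq hV hB hr

theorem deriv_radialCDF_of_lt [Nonempty (Fin n)] (hV : FullyIndecomposable V)
    (hB : HasMassBound V) {s : ℝ} (hsρ : Real.sqrt (rho V) < s) : deriv (radialCDF V) s = 0 := by
  have : radialCDF V =ᶠ[𝓝 s] fun _ => 1 := by
    filter_upwards [eventually_gt_nhds hsρ] with r hr
    have hr0 : 0 < r := (Real.sqrt_nonneg _).trans_lt hr
    rw [radialCDF_eq_cdfSq hV hB hr0, cdfSq_of_rho_le hV ((Real.sqrt_lt' hr0).1 hr).le]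
  rw [this.deriv_eq, deriv_const]

/-- The density with respect to the radius, as an extended nonnegative real. -/
def radialDensity (V : Matrix (Fin n) (Fin n) ℝ) (r : ℝ) : ENNReal :=
  ENNReal.ofReal (if r = Real.sqrt (rho V) then 0
    else 1 / (2 * Real.pi * r) * deriv (radialCDF V) r)

theorem ofReal_density (z : ℂ) : ENNReal.ofReal (density V z) = radialDensity V ‖z‖ := rfl

theorem measurable_radialDensity : Measurable (radialDensity V) := by
  refine ENNReal.measurable_ofReal.comp (Measurable.ite (measurableSet_singleton _)
    measurable_const (Measurable.mul ?_ (measurable_deriv _)))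
  fun_prop

theorem radialDensity_of_le [Nonempty (Fin n)] (hV : FullyIndecomposable V)
    (hB : HasMassBound V) {r : ℝ} (hr : Real.sqrt (rho V) ≤ r) : radialDensity V r = 0 := by
  rcases hr.eq_or_lt with h | h
  · simp [radialDensity, h]
  · simp [radialDensity, deriv_radialCDF_of_lt hV hB h]

theorem ofReal_mul_radialDensity [Nonempty (Fin n)] (hV : FullyIndecomposable V)
    (hB : HasMassBound V) {D : ℝ → ℝ}
    (hD : ∀ τ, 0 ≤ τ → τ < rho V → HasDerivWithinAt (cdfSq V) (D τ) (Ici 0) τ) {r : ℝ}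
    (hr : 0 < r) (hrρ : r < Real.sqrt (rho V)) :
    ENNReal.ofReal (2 * Real.pi * r) * radialDensity V r =
      ENNReal.ofReal (D (r ^ 2) * (2 * r)) := by
  have hpos : 0 < 2 * Real.pi * r := by positivity
  rw [radialDensity, if_neg hrρ.ne, deriv_radialCDF hV hB hD hr hrρ,
    ← ENNReal.ofReal_mul hpos.le, ← mul_assoc, mul_one_div_cancel hpos.ne', one_mul]

/-- Fundamental theorem of calculus. The sign of the derivative supplies integrability, so no bound
on it near the edge is needed. -/
theorem lintegral_radialDensity_of_le [Nonempty (Fin n)] (hV : FullyIndecomposable V)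
    (hB : HasMassBound V) {s : ℝ} (hs : 0 ≤ s) (hsρ : s ≤ Real.sqrt (rho V)) :
    ∫⁻ r in Ioc 0 s, ENNReal.ofReal (2 * Real.pi * r) * radialDensity V r =
      ENNReal.ofReal (cdfSq V (s ^ 2)) := by
  obtain ⟨D, hD, hDnn, -⟩ := exists_deriv_cdfSq hV hB
  have hcont : ContinuousOn (fun r => cdfSq V (r ^ 2)) (Icc 0 s) :=
    (continuousOn_cdfSq hV hB).comp (by fun_prop) fun r _ => sq_nonneg r
  have hderiv : ∀ r ∈ Ioo 0 s,
      HasDerivAt (fun r => cdfSq V (r ^ 2)) (D (r ^ 2) * (2 * r)) r := fun r hr =>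
    hasDerivAt_cdfSq_sq hD hr.1 (hr.2.trans_le hsρ)
  have hnn : ∀ r ∈ Ioo 0 s, 0 ≤ D (r ^ 2) * (2 * r) := fun r hr =>
    mul_nonneg (hDnn _ (pow_pos hr.1 2) ((Real.lt_sqrt hr.1.le).1 (hr.2.trans_le hsρ)))
      (by linarith [hr.1])
  have hint := intervalIntegral.integrableOn_deriv_of_nonneg hcont hderiv hnn
  have hval := intervalIntegral.integral_eq_sub_of_hasDerivAt_of_le hs hcont hderiv
    ((intervalIntegrable_iff_integrableOn_Ioc_of_le hs).2 hint)
  rw [intervalIntegral.integral_of_le hs] at hval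
  simp only [ne_eq, OfNat.ofNat_ne_zero, not_false_eq_true, zero_pow, cdfSq_zero hV hB,
    sub_zero] at hval
  rw [← hval, integral_Ioc_eq_integral_Ioo, ofReal_integral_eq_lintegral_ofReal
    (hint.mono_set Ioo_subset_Ioc_self) (ae_restrict_of_forall_mem measurableSet_Ioo hnn),
    setLIntegral_congr Ioo_ae_eq_Ioc.symm]
  exact setLIntegral_congr_fun measurableSet_Ioo fun r hr =>
    ofReal_mul_radialDensity hV hB hD hr.1 (hr.2.trans_le hsρ)

theorem lintegral_radialDensity [Nonempty (Fin n)] (hV : FullyIndecomposable V)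
    (hB : HasMassBound V) {s : ℝ} (hs : 0 ≤ s) :
    ∫⁻ r in Ioi 0, ENNReal.ofReal (2 * Real.pi * r) * (Iic s).indicator (radialDensity V) r =
      ENNReal.ofReal (cdfSq V (s ^ 2)) := by
  have hρ := hV.rho_pos_and_exists_eigenvector.1
  -- Beyond the edge the density vanishes and the distribution function is constant.
  set m := min s (Real.sqrt (rho V)) with hm
  have hm0 : 0 ≤ m := le_min hs (Real.sqrt_nonneg _)
  have h1 : cdfSq V (s ^ 2) = cdfSq V (m ^ 2) := by
    rcases le_total s (Real.sqrt (rho V)) with h | h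
    · rw [hm, min_eq_left h]
    · rw [hm, min_eq_right h, Real.sq_sqrt hρ.le, cdfSq_of_rho_le hV le_rfl,
        cdfSq_of_rho_le hV ((Real.sqrt_le_left hs).1 h)]
  rw [h1, ← lintegral_radialDensity_of_le hV hB hm0 (min_le_right _ _), ← Ioi_inter_Iic,
    inter_comm,
    ← setLIntegral_indicator measurableSet_Iic]
  refine setLIntegral_congr_fun measurableSet_Ioi fun r _ => ?_
  by_cases hr : r ≤ m
  · simp [hr, hr.trans (min_le_left _ _)]
  · rw [indicator_of_notMem (s := Iic m) (by simpa using hr)]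
    by_cases hrs : r ≤ s
    · have : Real.sqrt (rho V) ≤ r := by
        by_contra! hlt
        exact hr (le_min hrs hlt.le)
      simp [radialDensity_of_le hV hB this]
    · simp [hrs]

/-- The measure with density `density V` is the deterministic equivalent. -/
theorem isDeterministicEquivalent_withDensity [Nonempty (Fin n)] (hV : FullyIndecomposable V)
    (hB : HasMassBound V) : IsDeterministicEquivalent V
      ((volume : Measure ℂ).withDensity fun z => ENNReal.ofReal (density V z)) := by
  have hball : ∀ s : ℝ, 0 ≤ s → ((volume : Measure ℂ).withDensity
      fun z => ENNReal.ofReal (density V z)) {z | ‖z‖ ≤ s} =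
        ENNReal.ofReal (cdfSq V (s ^ 2)) := fun s hs => by
    have hset : MeasurableSet {z : ℂ | ‖z‖ ≤ s} := measurableSet_le measurable_norm measurable_const
    rw [withDensity_apply _ hset, ← lintegral_radialDensity hV hB hs, ← lintegral_comp_norm
      (measurable_radialDensity.indicator measurableSet_Iic), ← lintegral_indicator hset]
    rfl
  have hρ := hV.rho_pos_and_exists_eigenvector.1
  refine ⟨⟨?_⟩, fun w hw => ?_, fun s hs => ?_⟩
  · have h1 := hball (Real.sqrt (rho V)) (Real.sqrt_nonneg _)
    rw [Real.sq_sqrt hρ.le, cdfSq_of_rho_le hV le_rfl, ENNReal.ofReal_one] at h1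
    rw [← h1, ← measure_inter_add_sdiff univ (measurableSet_le (f := fun z : ℂ => ‖z‖)
      (g := fun _ => Real.sqrt (rho V)) measurable_norm measurable_const), univ_inter]
    convert add_zero _
    rw [withDensity_apply _ (MeasurableSet.univ.diff
      (measurableSet_le measurable_norm measurable_const))]
    refine (setLIntegral_congr_fun (g := fun _ => 0) (MeasurableSet.univ.diff
      (measurableSet_le measurable_norm measurable_const)) fun z hz => ?_).trans (by simp)
    have hz' : Real.sqrt (rho V) < ‖z‖ := not_le.1 hz.2
    exact radialDensity_of_le hV hB hz'.le
  · let c : Circle := ⟨w, mem_sphere_zero_iff_norm.2 hw⟩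
    have hmp : MeasurePreserving (fun z : ℂ => w * z) := (rotation c).measurePreserving
    have hm : Measurable fun z : ℂ => ENNReal.ofReal (density V z) :=
      measurable_radialDensity.comp measurable_norm
    ext s hs
    rw [Measure.map_apply hmp.measurable hs, withDensity_apply _ (hmp.measurable hs),
      withDensity_apply _ hs, ← hmp.setLIntegral_comp_preimage hs hm]
    refine lintegral_congr fun z => ?_
    rw [ofReal_density, ofReal_density, norm_mul, hw, one_mul]
  · have hnn : 0 ≤ cdfSq V (s ^ 2) := by
      by_cases h : s ^ 2 < rho V
      · rw [cdfSq_eq_mul hV hB (sq_nonneg s) h]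
        have h1 := isPosSol_posSol hV hB (sq_nonneg s) h
        have h2 := hV.transpose.mulVec_pos h1.fst_pos
        have h3 := Finset.sum_nonneg fun i (_ : i ∈ Finset.univ) =>
          (div_pos (h1.fst_pos i) (h2 i)).le
        positivity
      · rw [cdfSq_of_rho_le hV (not_lt.1 h)]
        exact zero_le_one
    rw [measureReal_def, hball s hs.le, ENNReal.toReal_ofReal hnn, radialCDF_eq_cdfSq hV hB hs]

theorem detEquivalent_eq [Nonempty (Fin n)] (hV : FullyIndecomposable V)
    (hB : HasMassBound V) : detEquivalent V =
      (volume : Measure ℂ).withDensity fun z => ENNReal.ofReal (density V z) := by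
  have h1 := isDeterministicEquivalent_withDensity hV hB
  have h : ∃ μ, IsDeterministicEquivalent V μ := ⟨_, h1⟩
  rw [detEquivalent, dif_pos h]
  exact h.choose_spec.unique h1 (tendsto_radialCDF_zero hV hB)

/-- The chain rule factor `2s` cancels against `1/(2πs)`, leaving `D(s²)/π`. -/
theorem tendsto_density [Nonempty (Fin n)] (hV : FullyIndecomposable V)
    (hB : HasMassBound V) :
    Tendsto (density V) (𝓝[≠] 0) (𝓝 (slopeZero V / Real.pi)) := by
  obtain ⟨D, hD, -, hDt⟩ := exists_deriv_cdfSq hV hB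
  have hρ := Real.sqrt_pos.2 hV.rho_pos_and_exists_eigenvector.1
  have hnorm : Tendsto (fun z : ℂ => ‖z‖) (𝓝[≠] 0) (𝓝[>] 0) := tendsto_norm_nhdsNE_zero
  refine ((hDt.comp (tendsto_sq_nhdsGE.comp hnorm)).div_const Real.pi).congr' ?_
  filter_upwards [hnorm.eventually (eventually_mem_nhdsWithin.and
    (nhdsWithin_le_nhds (eventually_lt_nhds hρ)))] with z hz
  have hz0 : 0 < ‖z‖ := hz.1
  rw [density, if_neg hz.2.ne, deriv_radialCDF hV hB hD hz0 hz.2]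
  simp only [Function.comp_apply]
  field_simp

/-! ### The density at the origin -/

theorem IsPosSol.fst_mul_eq_one (hV : FullyIndecomposable V) {p : (Fin n → ℝ) × (Fin n → ℝ)}
    (h : IsPosSol V 0 0 p) (i : Fin n) : p.1 i * (V *ᵥ p.2) i = 1 := by
  have h1 := h.fst_eq i
  simp only [add_zero, zero_add] at h1
  have h2 := (hV.transpose.mulVec_pos h.fst_pos i).ne'
  exact mul_right_cancel₀ h2 (by linear_combination h1)

theorem IsPosSol.snd_mul_eq_one (hV : FullyIndecomposable V) {p : (Fin n → ℝ) × (Fin n → ℝ)}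
    (h : IsPosSol V 0 0 p) (i : Fin n) : p.2 i * (Vᵀ *ᵥ p.1) i = 1 :=
  h.swap.fst_mul_eq_one hV.transpose i

theorem massBound_nonneg {K : ℕ} {φ c R : ℝ} (hφ : 0 < φ) (hc : 0 ≤ c) (hR : 0 ≤ R) :
    0 ≤ massBound K φ c R := by
  unfold massBound
  positivity

/-- A bound for all entries of `V q̃` and `Vᵀ q` at the origin. -/
def rowBound (K : ℕ) (φ c : ℝ) : ℝ := c * (massBound K φ c 0 + 1)

/-- The summand `1` in `rowBound` keeps it positive for `K = 0`, which can occur when there are no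
dimensions to consider. -/
theorem rowBound_pos {K : ℕ} {φ c : ℝ} (hφ : 0 < φ) (hc : 0 < c) : 0 < rowBound K φ c := by
  have := massBound_nonneg (K := K) hφ hc.le le_rfl
  unfold rowBound
  positivity

theorem IsBlockMap.transpose_mulVec_le {K : ℕ} {φ c : ℝ} (hφ : 0 < φ) (hc : 0 < c)
    {Z : Matrix (Fin K) (Fin K) ℝ} {κ : Fin n → Fin K} (h : IsBlockMap φ c Z V κ)
    (hn : (0 : ℝ) < n) {p : (Fin n → ℝ) × (Fin n → ℝ)} (hp : IsPosSol V 0 0 p) (i : Fin n) :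
    (Vᵀ *ᵥ p.1) i ≤ rowBound K φ c := by
  refine (h.transpose.mulVec_le (fun i => (hp.fst_pos i).le) i).trans ?_
  have := h.sum_le hφ hc.le hn le_rfl le_rfl le_rfl zero_le_one hp
  exact mul_le_mul_of_nonneg_left (by linarith) hc.le

/-- The bound on `Vᵀq` bounds `q̃` below by the Sinkhorn identity, hence its block masses and `Vq̃`
below, and so `q` above by the other identity. -/
theorem IsBlockMap.fst_le {K : ℕ} {φ c : ℝ} (hφ : 0 < φ) (hc : 0 < c)
    {Z : Matrix (Fin K) (Fin K) ℝ} {κ : Fin n → Fin K} (h : IsBlockMap φ c Z V κ)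
    (hn : (0 : ℝ) < n) {p : (Fin n → ℝ) × (Fin n → ℝ)} (hp : IsPosSol V 0 0 p) (i : Fin n) :
    p.1 i ≤ K * rowBound K φ c / φ := by
  have hV := h.fullyIndecomposable hφ
  have hL := rowBound_pos (K := K) hφ hc
  have hK : (0 : ℝ) < K := by exact_mod_cast (κ i).pos
  obtain ⟨l, hl⟩ := h.fid.exists_pos (κ i)
  have h1 : ∀ y, 1 / rowBound K φ c ≤ p.2 y := fun y => by
    rw [div_le_iff₀ hL, ← hp.snd_mul_eq_one hV y]
    exact mul_le_mul_of_nonneg_left (h.transpose_mulVec_le hφ hc hn hp y) (hp.snd_pos y).le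
  have h2 : 1 / (K * rowBound K φ c) ≤ blockMass κ p.2 l := by
    have h3 := Finset.card_nsmul_le_sum (Finset.univ.filter fun x => κ x = l) p.2 _
      fun y _ => h1 y
    rw [nsmul_eq_mul, h.card_eq] at h3
    rw [blockMass, le_div_iff₀ hn]
    refine le_of_eq_of_le ?_ h3
    field_simp
  have h4 := (mul_le_mul_of_nonneg_left h2 hφ.le).trans
    (h.le_mulVec (fun i => (hp.snd_pos i).le) hl.ne')
  have h5 := mul_le_mul_of_nonneg_left h4 (hp.fst_pos i).le
  rw [hp.fst_mul_eq_one hV, mul_one_div, ← mul_div_assoc, div_le_one (by positivity)] at h5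
  rwa [le_div_iff₀ hφ]

theorem IsBlockMap.density_bounds {K : ℕ} {φ c : ℝ} (hφ : 0 < φ) (hc : 0 < c)
    {Z : Matrix (Fin K) (Fin K) ℝ} {κ : Fin n → Fin K} (h : IsBlockMap φ c Z V κ)
    (hn : (0 : ℝ) < n) {p : (Fin n → ℝ) × (Fin n → ℝ)} (hp : IsPosSol V 0 0 p) :
    1 / Real.pi * (1 / rowBound K φ c) ^ 2 ≤ 1 / (Real.pi * n) * ∑ i, p.1 i * p.2 i ∧
      1 / (Real.pi * n) * ∑ i, p.1 i * p.2 i ≤ 1 / Real.pi * (K * rowBound K φ c / φ) ^ 2 := by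
  have hV := h.fullyIndecomposable hφ
  have hL := rowBound_pos (K := K) hφ hc
  have h1 : ∀ i, 1 / rowBound K φ c ≤ p.2 i := fun i => by
    rw [div_le_iff₀ hL, ← hp.snd_mul_eq_one hV i]
    exact mul_le_mul_of_nonneg_left (h.transpose_mulVec_le hφ hc hn hp i) (hp.snd_pos i).le
  have h2 : ∀ i, 1 / rowBound K φ c ≤ p.1 i := fun i => by
    rw [div_le_iff₀ hL, ← hp.fst_mul_eq_one hV i]
    exact mul_le_mul_of_nonneg_left (h.transpose.transpose_mulVec_le hφ hc hn hp.swap i)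
      (hp.fst_pos i).le
  have h3 := h.fst_le hφ hc hn hp
  have h4 := h.transpose.fst_le hφ hc hn hp.swap
  have h5 : ∀ i, (1 / rowBound K φ c) ^ 2 ≤ p.1 i * p.2 i := fun i => by
    rw [sq]
    exact mul_le_mul (h2 i) (h1 i) (by positivity) (hp.fst_pos i).le
  have h6 : ∀ i, p.1 i * p.2 i ≤ (K * rowBound K φ c / φ) ^ 2 := fun i => by
    rw [sq]
    exact mul_le_mul (h3 i) (h4 i) (hp.snd_pos i).le ((hp.fst_pos i).le.trans (h3 i))
  have h7 := Finset.card_nsmul_le_sum Finset.univ _ _ fun i _ => h5 i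
  have h8 := Finset.sum_le_card_nsmul Finset.univ _ _ fun i _ => h6 i
  rw [Finset.card_univ, Fintype.card_fin, nsmul_eq_mul] at h7 h8
  have h9 : 0 ≤ 1 / (Real.pi * n) := by positivity
  have h10 : ∀ x : ℝ, 1 / Real.pi * x = 1 / (Real.pi * n) * (n * x) := fun x => by
    field_simp
  rw [h10, h10]
  exact ⟨mul_le_mul_of_nonneg_left h7 h9, mul_le_mul_of_nonneg_left h8 h9⟩

theorem IsPosSol.one_div_mul_eq (hV : FullyIndecomposable V) {p : (Fin n → ℝ) × (Fin n → ℝ)}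
    (h : IsPosSol V 0 0 p) (i : Fin n) :
    1 / ((Vᵀ *ᵥ p.1) i * (V *ᵥ p.2) i) = p.1 i * p.2 i := by
  have h1 := h.fst_mul_eq_one hV i
  have h2 := h.snd_mul_eq_one hV i
  have h3 := hV.transpose.mulVec_pos h.fst_pos i
  have h4 := hV.mulVec_pos h.snd_pos i
  rw [div_eq_iff (mul_pos h3 h4).ne']
  linear_combination -h1 - p.1 i * (V *ᵥ p.2) i * h2

theorem slopeZero_div_pi [Nonempty (Fin n)] (hV : FullyIndecomposable V) (hB : HasMassBound V) :
    slopeZero V / Real.pi =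
      1 / (Real.pi * n) * ∑ i, (posSol V 0).1 i * (posSol V 0).2 i := by
  have h := isPosSol_posSol hV hB le_rfl hV.rho_pos_and_exists_eigenvector.1
  have h1 : ∀ i, (posSol V 0).1 i / (Vᵀ *ᵥ (posSol V 0).1) i =
      (posSol V 0).1 i * (posSol V 0).2 i := fun i => by
    rw [div_eq_iff (hV.transpose.mulVec_pos h.fst_pos i).ne']
    linear_combination -(posSol V 0).1 i * h.snd_mul_eq_one hV i
  rw [slopeZero, Finset.sum_congr rfl fun i _ => h1 i, div_eq_mul_one_div, mul_right_comm,
    one_div_mul_one_div, mul_comm (n : ℝ)]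

end VarianceProfile

end

/-! ### The main theorem -/

theorem proposition2
    -- the dimensions `n` along which the sequence is considered
    (S : Set ℕ) (hS : ∀ n ∈ S, 1 ≤ n)
    -- the standard deviation profiles
    (A : ∀ n : ℕ, Matrix (Fin n) (Fin n) ℝ)
    (hA : ∀ n ∈ S, ∀ i j, 0 ≤ A n i j)
    -- bounded variances
    (hbdd : ∃ σmax : ℝ, 0 < σmax ∧ ∀ n ∈ S, ∀ i j, A n i j ≤ σmax)
    -- block full indecomposability, with constants independent of `n`
    (hBFID : ∃ φ : ℝ, 0 < φ ∧ ∃ K : ℕ, ∀ n ∈ S,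
      BlockFullyIndecomposable φ K (normalizedProfile (A n))) :
    ∃ κ C : ℝ, 0 < κ ∧ ∀ n ∈ S, ∀ V : Matrix (Fin n) (Fin n) ℝ, V = normalizedProfile (A n) →
      ∃ q₀ qt₀ : Fin n → ℝ,
        -- the two limits exist and are equal
        Tendsto (fun t : ℝ => regularizedSolution V 0 t) (𝓝[>] 0) (𝓝 (q₀, qt₀)) ∧
        Tendsto (fun s : ℝ => masterSolution V s) (𝓝[>] 0) (𝓝 (q₀, qt₀)) ∧
        -- the Sinkhorn-type identities
        (∀ i, q₀ i * (V *ᵥ qt₀) i = 1) ∧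
        (∀ i, qt₀ i * (Vᵀ *ᵥ q₀) i = 1) ∧
        -- `μ_n` is a genuine radial probability measure, and it has no atom at zero
        IsDeterministicEquivalent V (detEquivalent V) ∧
        detEquivalent V {0} = 0 ∧
        -- `f_n` is the density of `μ_n` on `ℂ \ {0}`
        (detEquivalent V).restrict {0}ᶜ =
          ((volume : Measure ℂ).withDensity fun z => ENNReal.ofReal (density V z)).restrict {0}ᶜ ∧
        -- it has a limit at zero, given by two formulas and bounded uniformly in `n`
        ∃ f₀ : ℝ,
          Tendsto (density V) (𝓝[≠] 0) (𝓝 f₀) ∧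
          f₀ = 1 / (Real.pi * n) * ∑ i, 1 / ((Vᵀ *ᵥ q₀) i * (V *ᵥ qt₀) i) ∧
          f₀ = 1 / (Real.pi * n) * ∑ i, q₀ i * qt₀ i ∧
          κ ≤ f₀ ∧ f₀ ≤ C := by
  obtain ⟨σ, hσ, hAσ⟩ := hbdd
  obtain ⟨φ, hφ, K, hBF⟩ := hBFID
  have hc : 0 < σ ^ 2 := pow_pos hσ 2
  have hL := rowBound_pos (K := K) hφ hc
  -- The constants depend only on `φ`, `K` and `c = σmax²`, the entrywise bound for `nV`.
  refine ⟨1 / Real.pi * (1 / rowBound K φ (σ ^ 2)) ^ 2,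
    1 / Real.pi * (K * rowBound K φ (σ ^ 2) / φ) ^ 2, by positivity, ?_⟩
  rintro n hn V rfl
  have hn1 := hS n hn
  have hn0 : (0 : ℝ) < n := by exact_mod_cast hn1
  have : Nonempty (Fin n) := ⟨⟨0, hn1⟩⟩
  obtain ⟨Z, κ, hZ⟩ := (hBF n hn).exists_isBlockMap (c := σ ^ 2)
    (fun x y => div_nonneg (sq_nonneg _) hn0.le)
    (fun x y => div_le_div_of_nonneg_right
      (pow_le_pow_left₀ (hA n hn x y) (hAσ n hn x y) 2) hn0.le)
  set V := normalizedProfile (A n)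
  have hV := hZ.fullyIndecomposable hφ
  have hB := hZ.hasMassBound hφ hc.le hn0
  have hp := isPosSol_posSol hV hB le_rfl hV.rho_pos_and_exists_eigenvector.1
  have hμ := isDeterministicEquivalent_withDensity hV hB
  have hdet := detEquivalent_eq hV hB
  have hbounds := hZ.density_bounds hφ hc hn0 hp
  refine ⟨(posSol V 0).1, (posSol V 0).2, tendsto_regularizedSolution hV hB,
    tendsto_masterSolution hV hB, hp.fst_mul_eq_one hV, hp.snd_mul_eq_one hV, hdet ▸ hμ, ?_,
    by rw [hdet], 1 / (Real.pi * n) * ∑ i, (posSol V 0).1 i * (posSol V 0).2 i, ?_, ?_, rfl,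
    hbounds.1, hbounds.2⟩
  · rw [hdet]
    exact hμ.measure_zero (tendsto_radialCDF_zero hV hB)
  · rw [← slopeZero_div_pi hV hB]
    exact tendsto_density hV hB
  · rw [Finset.sum_congr rfl fun i _ => hp.one_div_mul_eq hV i]
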